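/- There is a universal constant $c$ with $0<c<1$ such that the following holds for all integers $n\ge 1$ and $1\le i\le j\le n$. Let $n$ qubits labelled $1,\dots,n$ be prepared in the state $|0\rangle^{\otimes n}$, and apply the random circuit $C$ that consists of a first layer of two-qubit gates on the pairs $(k,k+1)$ for all odd $k\in\{1,\dots,n-1\}$, followed by a second layer of two-qubit gates on the pairs $(k,k+1)$ for all even $k\in\{1,\dots,n-1\}$, all gates being independent and distributed according to the Haar probability measure on the unitary group $U(4)$. Measure the qubits of the block $B:=\{i,i+1,\dots,j\}$ of the output state in the computational basis. For an outcome $b$, let $\psi_b$ be the normalized post-measurement pure state on the unmeasured qubits, let $A:=\{1,\dots,i-1\}$ be the set of qubits to the left of $B$, and let $S(A)_{\psi_b}=-\operatorname{Tr}(\rho_A\log_2\rho_A)$ be the von Neumann entropy of the reduced density matrix $\rho_A$ of $\psi_b$ on $A$ (with $0\log_2 0=0$; the entropy is $0$ if $A$ is empty). Then $$\mathbb{E}_{C,b}\, S(A)_{\psi_b}\le c^{|B|},$$ where $|B|=j-i+1$ and the expectation is over the choice of the random circuit $C$ and over the measurement outcome $b$ (distributed by the Born rule given $C$). The expectation is well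 defined: given $C$, the mean of $S(A)_{\psi_b}$ over $b$ is an integrable function of $C$. -/

import Mathlib

open MeasureTheory

noncomputable section

namespace RandomCircuit

/-! ### Haar-random two-qubit gates -/

/-- The unitary group `U(4)` of two-qubit gates; `Fin 2 × Fin 2` labels the computational basis of
a pair of qubits. -/
abbrev Gate : Type := Matrix.unitaryGroup (Fin 2 × Fin 2) ℂ

instance gateMeasurableSpace : MeasurableSpace Gate := borel Gate

instance gateBorelSpace : BorelSpace Gate := ⟨rfl⟩

instance gateCompactSpace : CompactSpace Gate := by
  refine isCompact_iff_compactSpace.mp ?_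
  have hK : IsCompact
      {M : Matrix (Fin 2 × Fin 2) (Fin 2 × Fin 2) ℂ | ∀ x y, M x y ∈ Metric.closedBall (0 : ℂ) 1} := by
    have h := isCompact_univ_pi (fun _ : Fin 2 × Fin 2 =>
      isCompact_univ_pi (fun _ : Fin 2 × Fin 2 => isCompact_closedBall (0 : ℂ) 1))
    have e : {M : Matrix (Fin 2 × Fin 2) (Fin 2 × Fin 2) ℂ |
        ∀ x y, M x y ∈ Metric.closedBall (0 : ℂ) 1} =
        Set.univ.pi (fun _ : Fin 2 × Fin 2 =>
          Set.univ.pi (fun _ : Fin 2 × Fin 2 => Metric.closedBall (0 : ℂ) 1)) := by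
      apply Set.ext
      intro M
      exact ⟨fun hM x _ y _ => hM x y, fun hM x y => hM x trivial y trivial⟩
    rw [e]
    exact h
  refine hK.of_isClosed_subset isClosed_unitary ?_
  intro M hM x y
  simpa using entry_norm_bound_of_unitary hM x y

/-- The Haar probability measure on the compact group `U(4)`: the translation-invariant measure
giving the whole group mass one. -/
def haarGate : Measure Gate := Measure.haarMeasure (⊤ : TopologicalSpace.PositiveCompacts Gate)

instance haarGate_isProbabilityMeasure : IsProbabilityMeasure haarGate :=
  ⟨by simpa [haarGate] using
    Measure.haarMeasure_self (K₀ := (⊤ : TopologicalSpace.PositiveCompacts Gate))⟩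

/-! ### The depth-two circuit

The qubits `1, …, n` are the elements of `Fin n`: the qubit `q : Fin n` carries the label `q + 1`. -/

/-- A (not necessarily normalized) vector of the `n`-qubit Hilbert space `(ℂ²)^{⊗ n}`, given by its
amplitudes in the computational basis. -/
abbrev StateVec (n : ℕ) : Type := (Fin n → Fin 2) → ℂ

/-- The state `|0 ⋯ 0⟩`. -/
def zeroState (n : ℕ) : StateVec n := fun s => if s = 0 then 1 else 0

/-- The gate `U` applied to the qubits `x` and `y` (tensored with the identity on the others). -/
def applyGate {n : ℕ} (U : Gate) (x y : Fin n) (ψ : StateVec n) : StateVec n := fun s =>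
  ∑ t : Fin 2 × Fin 2,
    (U : Matrix (Fin 2 × Fin 2) (Fin 2 × Fin 2) ℂ) (s x, s y) t *
      ψ (Function.update (Function.update s x t.1) y t.2)

/-- An instance of the circuit: one two-qubit gate for each pair of neighbouring qubits. The index
`k : Fin (n - 1)` stands for the pair of qubits labelled `k + 1` and `k + 2`. -/
abbrev Circuit (n : ℕ) : Type := Fin (n - 1) → Gate

/-- The left qubit (label `k + 1`) of the pair `k`. -/
def leftQubit {n : ℕ} (k : Fin (n - 1)) : Fin n := ⟨k, by omega⟩

/-- The right qubit (label `k + 2`) of the pair `k`. -/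
def rightQubit {n : ℕ} (k : Fin (n - 1)) : Fin n := ⟨k + 1, by omega⟩

/-- Apply the gates of `C` on the pairs `k` satisfying `p`, in increasing order of `k`. -/
def applyLayer {n : ℕ} (p : Fin (n - 1) → Prop) [DecidablePred p] (C : Circuit n)
    (ψ : StateVec n) : StateVec n :=
  ((List.finRange (n - 1)).filter (fun k => decide (p k))).foldl
    (fun φ k => applyGate (C k) (leftQubit k) (rightQubit k) φ) ψ

/-- The output state on input `|0 ⋯ 0⟩`: first the gates on the pairs whose left qubit has an odd
label, then those on the pairs whose left qubit has an even label. -/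
def outputState {n : ℕ} (C : Circuit n) : StateVec n :=
  applyLayer (fun k => Even ((k : ℕ) + 1)) C
    (applyLayer (fun k => Odd ((k : ℕ) + 1)) C (zeroState n))

/-- The law of the random circuit: independent Haar-random gates. -/
def circuitLaw (n : ℕ) : Measure (Circuit n) := Measure.pi (fun _ => haarGate)

/-! ### Measuring a block of qubits -/

/-- Computational basis labels of the qubits to the left of the qubit `i`. -/
abbrev LeftConf {n : ℕ} (i : Fin n) : Type := {q : Fin n // q < i} → Fin 2

/-- Computational basis labels of the block of the qubits from `i` to `j`. -/
abbrev BlockConf {n : ℕ} (i j : Fin n) : Type := {q : Fin n // i ≤ q ∧ q ≤ j} → Fin 2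

/-- Computational basis labels of the qubits to the right of the qubit `j`. -/
abbrev RightConf {n : ℕ} (j : Fin n) : Type := {q : Fin n // j < q} → Fin 2

/-- The basis label of all qubits composed of those of the three regions. -/
def glue {n : ℕ} {i j : Fin n} (a : LeftConf i) (b : BlockConf i j) (c : RightConf j) :
    Fin n → Fin 2 := fun q =>
  if hi : q < i then a ⟨q, hi⟩
  else if hj : q ≤ j then b ⟨q, not_lt.mp hi, hj⟩
  else c ⟨q, not_le.mp hj⟩

/-- The probability of the outcome `b` when the qubits from `i` to `j` of the state `ψ` are measured
in the computational basis. -/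
def outcomeProb {n : ℕ} {i j : Fin n} (ψ : StateVec n) (b : BlockConf i j) : ℝ :=
  ∑ a : LeftConf i, ∑ c : RightConf j, ‖ψ (glue a b c)‖ ^ 2

/-- The normalized post-measurement state on the unmeasured qubits after the outcome `b`, as a vector
of the tensor product of the left region and the right region (it is `0` for an outcome of
probability zero). -/
def postState {n : ℕ} {i j : Fin n} (ψ : StateVec n) (b : BlockConf i j) :
    LeftConf i × RightConf j → ℂ := fun s =>
  ψ (glue s.1 b s.2) / (Real.sqrt (outcomeProb ψ b) : ℂ)

/-! ### Entanglement entropy -/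

/-- The reduced density matrix on the first tensor factor of the pure state `φ`. -/
def reducedDensity {α β : Type*} [Fintype β] (φ : α × β → ℂ) : Matrix α α ℂ :=
  Matrix.of fun a a' => ∑ c : β, φ (a, c) * star (φ (a', c))

theorem reducedDensity_isHermitian {α β : Type*} [Fintype β] (φ : α × β → ℂ) :
    (reducedDensity φ).IsHermitian := by
  ext a a'
  simp [reducedDensity, Matrix.conjTranspose_apply, mul_comm]

/-- The von Neumann entropy `-Tr (ρ log₂ ρ)` in bits, with `0 log₂ 0 = 0`, through the
eigenvalues of `ρ`. -/
def vonNeumannEntropy {α : Type*} [Fintype α] [DecidableEq α] {ρ : Matrix α α ℂ}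
    (hρ : ρ.IsHermitian) : ℝ :=
  -∑ k : α, hρ.eigenvalues k * Real.logb 2 (hρ.eigenvalues k)

/-- The entanglement entropy of the pure state `φ` between its two tensor factors. -/
def entanglementEntropy {α β : Type*} [Fintype α] [DecidableEq α] [Fintype β]
    (φ : α × β → ℂ) : ℝ :=
  vonNeumannEntropy (reducedDensity_isHermitian φ)

/-- The expectation over the outcome `b` of measuring the qubits from `i` to `j` of `ψ` of the
entropy of the left region in the post-measurement state. -/
def expectedPostEntropy {n : ℕ} (i j : Fin n) (ψ : StateVec n) : ℝ :=
  ∑ b : BlockConf i j, outcomeProb ψ b * entanglementEntropy (postState ψ b)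

end RandomCircuit

end

/-!
The output of the two-layer circuit is a matrix product state of bond dimension two, with one
`2 × 2` matrix for each pair of neighbouring qubits (`outputState_eq_chainVec`). A gate of the first
layer contributes the amplitude matrix of the two-qubit state it prepares from `|00⟩`; a gate of the
second layer contributes its row belonging to the output labels of its two qubits. Hence, after the
outcome `b`, the unnormalized state of the unmeasured qubits is a product `P * M * R`, where `M` is
the product of the matrices within the block and `P`, `R` carry the left and right regions
(`outputState_glue`). In particular its Schmidt rank is at most two.

For such a state the entropy is at most the concurrence, twice the product of the two Schmidt
coefficients (`purityEntropy_le`, from `h(x) ≤ 2 √(x (1 - x))` for the binary entropy `h`). The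
concurrence times the probability of the outcome is
`2 √(det (P† P)) |det M| √(det (R R†))`, which no longer contains the normalization and is
multiplicative along the chain (`mul_entropy_le`).

The sum over the outcomes is a transfer-matrix computation (`chainVec_det_le`). For `2 × 2` matrices
`2 √(det (V† V)) ≤ tr (V† V)`, and the traces belonging to a second-layer gate add up over its
outcomes to a constant by unitarity, so the second layer is summed out whatever its gates are. What
remains, for each instance of the circuit, is the product of the concurrences of the states prepared
by the first layer on the pairs that meet the block (`expectedPostEntropy_le`).
A pair missing at the right boundary counts as concurrence zero, in accordance with the entropy being
zero there.

There are at least `|B| / 2` such pairs, their gates are independent, and the mean concurrence of a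
Haar-random two-qubit state is less than `1`; its square root (or `1 / √2`, if that is larger) serves
as the constant.
-/

noncomputable section

namespace RandomCircuit

open scoped ComplexOrder

/-! ### Entropy of matrices of rank at most two -/

/-- With `t² = x / (1 - x)` the left side is `binEntropy x / √(x (1 - x))`; it increases with `t`
because `(1 - z) log (1 + z) ≤ (1 - z) z ≤ -z log z` for `z = t²`. -/
theorem entropy_ratio_le {t : ℝ} (h0 : 0 < t) (h1 : t ≤ 1) :
    (t⁻¹ + t) * Real.log (1 + t ^ 2) - 2 * t * Real.log t ≤ 2 * Real.log 2 := by
  set f : ℝ → ℝ := fun t => (t⁻¹ + t) * Real.log (1 + t ^ 2) - 2 * t * Real.log t with hf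
  have hder : ∀ x : ℝ, 0 < x → HasDerivAt f
      ((1 - (x ^ 2)⁻¹) * Real.log (1 + x ^ 2) - 2 * Real.log x) x := by
    intro x hx
    have hx2 : (1 + x ^ 2) ≠ 0 := by positivity
    have a1 := (hasDerivAt_inv hx.ne').add (hasDerivAt_id x)
    have a2 := (((hasDerivAt_id x).pow 2).const_add 1).log hx2
    have a3 := ((hasDerivAt_id x).const_mul 2).mul (Real.hasDerivAt_log hx.ne')
    refine ((a1.mul a2).sub a3).congr_deriv ?_
    simp
    field_simp
    ring
  have hmono : MonotoneOn f (Set.Ioc 0 1) := by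
    refine monotoneOn_of_deriv_nonneg (convex_Ioc 0 1)
      (fun x hx => (hder x hx.1).continuousAt.continuousWithinAt) ?_ ?_
    · intro x hx
      rw [interior_Ioc] at hx
      exact (hder x hx.1).differentiableAt.differentiableWithinAt
    · intro x hx
      rw [interior_Ioc] at hx
      obtain ⟨hx0, hx1⟩ := hx
      rw [(hder x hx0).deriv]
      have hz : 0 < x ^ 2 := by positivity
      have hz1 : x ^ 2 ≤ 1 := by nlinarith
      have l1 : Real.log (1 + x ^ 2) ≤ x ^ 2 := by
        have := Real.log_le_sub_one_of_pos (show 0 < 1 + x ^ 2 by positivity)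
        linarith
      have l2 : 2 * Real.log x ≤ x ^ 2 - 1 := by
        have := Real.log_le_sub_one_of_pos hz
        rw [Real.log_pow] at this
        simpa using this
      have l3 : (1 - (x ^ 2)⁻¹) * x ^ 2 = x ^ 2 - 1 := by field_simp
      have l4 : 1 - (x ^ 2)⁻¹ ≤ 0 := by
        have := (one_le_inv₀ hz).2 hz1
        linarith
      nlinarith [mul_le_mul_of_nonpos_left l1 l4]
  have := hmono ⟨h0, h1⟩ ⟨one_pos, le_rfl⟩ h1
  simp only [hf] at this
  norm_num at this
  linarith

theorem binEntropy_le_of_le_half {x : ℝ} (h0 : 0 ≤ x) (h1 : x ≤ 1 / 2) :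
    Real.binEntropy x ≤ 2 * Real.log 2 * √(x * (1 - x)) := by
  rcases h0.eq_or_lt with rfl | h0
  · simp
  have hy : 0 < 1 - x := by linarith
  set t := √(x / (1 - x)) with ht
  have ht0 : 0 < t := Real.sqrt_pos.2 (by positivity)
  have ht2 : t ^ 2 = x / (1 - x) := Real.sq_sqrt (by positivity)
  have ht1 : t ≤ 1 := by
    rw [ht, Real.sqrt_le_one, div_le_one hy]
    linarith
  have key := entropy_ratio_le ht0 ht1
  have hx : 1 + t ^ 2 = (1 - x)⁻¹ := by rw [ht2]; field_simp; ring
  have hlt : 2 * Real.log t = Real.log x - Real.log (1 - x) := by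
    have := congrArg Real.log ht2
    rwa [Real.log_pow, Real.log_div h0.ne' hy.ne'] at this
  have hs : √(x * (1 - x)) = t * (1 - x) := by
    rw [Real.sqrt_eq_iff_mul_self_eq (by positivity) (by positivity)]
    calc x * (1 - x) = x / (1 - x) * (1 - x) ^ 2 := by field_simp
      _ = t * (1 - x) * (t * (1 - x)) := by rw [← ht2]; ring
  have e : Real.binEntropy x =
      ((t⁻¹ + t) * Real.log (1 + t ^ 2) - 2 * t * Real.log t) * (t * (1 - x)) := by
    have e1 : t⁻¹ * t = 1 := inv_mul_cancel₀ ht0.ne'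
    have e2 : t ^ 2 * (1 - x) = x := by rw [ht2]; field_simp
    calc Real.binEntropy x = x * Real.log x⁻¹ + (1 - x) * Real.log (1 - x)⁻¹ := rfl
      _ = (t⁻¹ * t * (1 - x) + t ^ 2 * (1 - x)) * Real.log (1 + t ^ 2)
            - (t ^ 2 * (1 - x)) * (2 * Real.log t) := by
          rw [e1, e2, hx, hlt, Real.log_inv, Real.log_inv]
          ring
      _ = _ := by ring
  rw [e, hs]
  exact mul_le_mul_of_nonneg_right key (by positivity)

theorem binEntropy_le_sqrt {x : ℝ} (h0 : 0 ≤ x) (h1 : x ≤ 1) :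
    Real.binEntropy x ≤ 2 * Real.log 2 * √(x * (1 - x)) := by
  rcases le_total x (1 / 2) with h | h
  · exact binEntropy_le_of_le_half h0 h
  · have := binEntropy_le_of_le_half (x := 1 - x) (by linarith) (by linarith)
    rwa [Real.binEntropy_one_sub, sub_sub_cancel, mul_comm (1 - x)] at this

/-- The entropy in bits of a two-point distribution with purity `s`. -/
def purityEntropy (s : ℝ) : ℝ := Real.binEntropy ((1 + √(2 * s - 1)) / 2) / Real.log 2

theorem measurable_purityEntropy : Measurable purityEntropy := by
  unfold purityEntropy
  have : Continuous fun s : ℝ => Real.binEntropy ((1 + √(2 * s - 1)) / 2) / Real.log 2 := by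
    fun_prop
  exact this.measurable

theorem neg_sum_logb_pair {a b : ℝ} (h : a + b = 1) :
    -(a * Real.logb 2 a + b * Real.logb 2 b) = purityEntropy (a ^ 2 + b ^ 2) := by
  have hb : b = 1 - a := by linarith
  have hs : √(2 * (a ^ 2 + b ^ 2) - 1) = |a - b| := by
    rw [← Real.sqrt_sq_eq_abs]
    congr 1
    subst hb
    ring
  have e : Real.binEntropy a / Real.log 2 = -(a * Real.logb 2 a + b * Real.logb 2 b) := by
    rw [Real.binEntropy, Real.log_inv, Real.log_inv, Real.logb, Real.logb, hb]
    ring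
  rw [← e, purityEntropy, hs]
  congr 1
  rcases abs_cases (a - b) with ⟨h', _⟩ | ⟨h', _⟩ <;> rw [h']
  · congr 1; linarith
  · rw [show (1 + -(a - b)) / 2 = 1 - a by linarith, Real.binEntropy_one_sub]

/-- A function with at most two nonzero values is summed, after any transformation fixing `0`,
over two of them. -/
theorem exists_pair_sum {ι : Type*} [Fintype ι] [DecidableEq ι] (l : ι → ℝ)
    (h : Fintype.card {k // l k ≠ 0} ≤ 2) :
    ∃ a b : ℝ, (∀ f : ℝ → ℝ, f 0 = 0 → ∑ k, f (l k) = f a + f b) ∧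
      ((∀ k, 0 ≤ l k) → 0 ≤ a ∧ 0 ≤ b) := by
  have hc : (Finset.univ.filter fun k => l k ≠ 0).card ≤ 2 := by
    rwa [Fintype.card_subtype] at h
  have hsum : ∀ f : ℝ → ℝ, f 0 = 0 →
      ∑ k, f (l k) = ∑ k ∈ Finset.univ.filter (fun k => l k ≠ 0), f (l k) := by
    intro f hf
    rw [Finset.sum_filter]
    refine Finset.sum_congr rfl fun k _ => ?_
    by_cases hk : l k = 0 <;> simp [hk, hf]
  interval_cases hcard : (Finset.univ.filter fun k => l k ≠ 0).card
  · rw [Finset.card_eq_zero] at hcard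
    exact ⟨0, 0, fun f hf => by rw [hsum f hf, hcard]; simp [hf], fun _ => ⟨le_rfl, le_rfl⟩⟩
  · obtain ⟨x, hx⟩ := Finset.card_eq_one.1 hcard
    exact ⟨l x, 0, fun f hf => by rw [hsum f hf, hx]; simp [hf], fun h => ⟨h x, le_rfl⟩⟩
  · obtain ⟨x, y, hxy, hx⟩ := Finset.card_eq_two.1 hcard
    exact ⟨l x, l y, fun f hf => by rw [hsum f hf, hx, Finset.sum_pair hxy],
      fun h => ⟨h x, h y⟩⟩

theorem trace_mul_self_eq_sum_eigenvalues {ι : Type*} [Fintype ι] [DecidableEq ι]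
    {ρ : Matrix ι ι ℂ} (hρ : ρ.IsHermitian) :
    (ρ * ρ).trace = ∑ k, ((hρ.eigenvalues k ^ 2 : ℝ) : ℂ) := by
  conv_lhs => rw [hρ.spectral_theorem]
  rw [← map_mul, Unitary.conjStarAlgAut_apply, Matrix.trace_mul_cycle, ]
  simp [Matrix.trace_diagonal, sq]

theorem entropy_eq_purityEntropy {ι : Type*} [Fintype ι] [DecidableEq ι]
    {ρ : Matrix ι ι ℂ} (hρ : ρ.IsHermitian) (hr : ρ.rank ≤ 2) (ht : ρ.trace = 1) :
    vonNeumannEntropy hρ = purityEntropy (ρ * ρ).trace.re := by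
  rw [hρ.rank_eq_card_non_zero_eigs] at hr
  obtain ⟨a, b, hab, -⟩ := exists_pair_sum _ hr
  have h1 : a + b = 1 := by
    rw [hρ.trace_eq_sum_eigenvalues] at ht
    have := hab id rfl
    simp only [id] at this
    rw [← this]
    refine Complex.ofReal_injective ?_
    rw [Complex.ofReal_sum]
    exact ht
  have h2 : (ρ * ρ).trace.re = a ^ 2 + b ^ 2 := by
    rw [trace_mul_self_eq_sum_eigenvalues hρ, ← hab (fun x => x ^ 2) (by simp), ← Complex.ofReal_sum,
      Complex.ofReal_re]
  rw [h2, ← neg_sum_logb_pair h1, vonNeumannEntropy,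
    hab (fun x => x * Real.logb 2 x) (by simp)]

theorem purityEntropy_nonneg {s : ℝ} (h1 : s ≤ 1) : 0 ≤ purityEntropy s := by
  have : √(2 * s - 1) ≤ 1 := Real.sqrt_le_one.2 (by linarith)
  have h0 := Real.sqrt_nonneg (2 * s - 1)
  exact div_nonneg (Real.binEntropy_nonneg (by linarith) (by linarith)) (Real.log_nonneg (by norm_num))

theorem purityEntropy_le {s : ℝ} (h1 : s ≤ 1) : purityEntropy s ≤ √(2 * (1 - s)) := by
  have l2 : 0 < Real.log 2 := Real.log_pos (by norm_num)
  rcases le_total s (1 / 2) with h0 | h0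
  · rw [purityEntropy, div_le_iff₀ l2]
    have : 1 ≤ √(2 * (1 - s)) := Real.one_le_sqrt.2 (by linarith)
    nlinarith [Real.binEntropy_le_log_two (p := (1 + √(2 * s - 1)) / 2)]
  have hr : √(2 * s - 1) ≤ 1 := Real.sqrt_le_one.2 (by linarith)
  have hr0 := Real.sqrt_nonneg (2 * s - 1)
  have hr2 : √(2 * s - 1) ^ 2 = 2 * s - 1 := Real.sq_sqrt (by linarith)
  rw [purityEntropy, div_le_iff₀ l2]
  refine (binEntropy_le_sqrt (by linarith) (by linarith)).trans_eq ?_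
  rw [show 2 * (1 - s) = 2 ^ 2 * ((1 + √(2 * s - 1)) / 2 * (1 - (1 + √(2 * s - 1)) / 2)) by
    linear_combination hr2, Real.sqrt_mul (x := 2 ^ 2) (by norm_num), Real.sqrt_sq (by norm_num)]
  ring

theorem reducedDensity_eq_mul {α β : Type*} [Fintype β] (φ : α × β → ℂ) :
    reducedDensity φ =
      (Matrix.of fun a c => φ (a, c)) * (Matrix.of fun a c => φ (a, c)).conjTranspose := by
  ext a a'
  simp [reducedDensity, Matrix.mul_apply]

theorem reducedDensity_div {α β : Type*} [Fintype β] (φ : α × β → ℂ) {p : ℝ} (hp : 0 ≤ p) :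
    reducedDensity (fun s => φ s / (√p : ℂ)) = ((p⁻¹ : ℝ) : ℂ) • reducedDensity φ := by
  ext a a'
  simp only [reducedDensity, Matrix.of_apply, Matrix.smul_apply, smul_eq_mul, Finset.mul_sum]
  refine Finset.sum_congr rfl fun c _ => ?_
  have : ((p⁻¹ : ℝ) : ℂ) = ((√p : ℝ) : ℂ)⁻¹ * ((√p : ℝ) : ℂ)⁻¹ := by
    rw [← mul_inv, ← Complex.ofReal_mul, Real.mul_self_sqrt hp, Complex.ofReal_inv]
  rw [this, star_div₀]
  simp only [Complex.star_def, Complex.conj_ofReal]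
  ring

theorem trace_reducedDensity {α β : Type*} [Fintype α] [Fintype β] (φ : α × β → ℂ) :
    (reducedDensity φ).trace = ((∑ a, ∑ c, ‖φ (a, c)‖ ^ 2 : ℝ) : ℂ) := by
  simp [Matrix.trace, reducedDensity, Complex.mul_conj, Complex.normSq_eq_norm_sq]

theorem trace_sq_fin_two (X : Matrix (Fin 2) (Fin 2) ℂ) :
    (X * X).trace = X.trace ^ 2 - 2 * X.det := by
  simp [Matrix.trace, Matrix.mul_apply, Fin.sum_univ_two, Matrix.det_fin_two]
  ring

/-- The purity of an unnormalized state of Schmidt rank at most two, given in the factored form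
`P * Q`, through its norm and the Gram determinants of the two factors. -/
theorem trace_sq_mul_factor {α β : Type*} [Fintype α] [Fintype β]
    (P : Matrix α (Fin 2) ℂ) (Q : Matrix (Fin 2) β ℂ) :
    (((P * Q) * (P * Q).conjTranspose) * ((P * Q) * (P * Q).conjTranspose)).trace =
      ((P * Q) * (P * Q).conjTranspose).trace ^ 2 -
        2 * ((P.conjTranspose * P).det * (Q * Q.conjTranspose).det) := by
  have h := trace_sq_fin_two ((P.conjTranspose * P) * (Q * Q.conjTranspose))
  rw [Matrix.det_mul] at h
  have h1 : ((P * Q) * (P * Q).conjTranspose).trace =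
      ((P.conjTranspose * P) * (Q * Q.conjTranspose)).trace := by
    rw [Matrix.conjTranspose_mul, ← Matrix.mul_assoc, Matrix.trace_mul_comm]
    simp only [Matrix.mul_assoc]
  have h2 : (((P * Q) * (P * Q).conjTranspose) * ((P * Q) * (P * Q).conjTranspose)).trace =
      (((P.conjTranspose * P) * (Q * Q.conjTranspose)) *
        ((P.conjTranspose * P) * (Q * Q.conjTranspose))).trace := by
    rw [Matrix.conjTranspose_mul, ← Matrix.mul_assoc, ← Matrix.mul_assoc, Matrix.trace_mul_comm]
    simp only [Matrix.mul_assoc]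
  rw [h1, h2, h]

theorem rank_reducedDensity_le {α β : Type*} [Fintype α] [Fintype β]
    (φ : α × β → ℂ) (P : Matrix α (Fin 2) ℂ) (Q : Matrix (Fin 2) β ℂ)
    (h : (Matrix.of fun a c => φ (a, c)) = P * Q) : (reducedDensity φ).rank ≤ 2 := by
  rw [reducedDensity_eq_mul, h, Matrix.mul_assoc]
  exact (Matrix.rank_mul_le_left _ _).trans ((Matrix.rank_le_card_width P).trans (by simp))

/-- The probability-weighted entanglement entropy of a normalized state of Schmidt rank at most two
as an explicit function of its reduced density matrix. -/
theorem mul_entropy_eq {α β : Type*} [Fintype α] [DecidableEq α] [Fintype β]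
    (φ : α × β → ℂ) (P : Matrix α (Fin 2) ℂ) (Q : Matrix (Fin 2) β ℂ)
    (h : (Matrix.of fun a c => φ (a, c)) = P * Q) {p : ℝ} (hp : p = ∑ a, ∑ c, ‖φ (a, c)‖ ^ 2) :
    p * entanglementEntropy (fun s => φ s / (√p : ℂ)) =
      p * purityEntropy (reducedDensity (fun s => φ s / (√p : ℂ)) *
        reducedDensity (fun s => φ s / (√p : ℂ))).trace.re := by
  have hp0 : 0 ≤ p := by rw [hp]; positivity
  rcases hp0.eq_or_lt with h0 | h0
  -- For `p = 0` the quotient is the zero vector rather than a state, but it has weight zero.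
  · rw [← h0, zero_mul, zero_mul]
  · rw [entanglementEntropy, entropy_eq_purityEntropy]
    · refine rank_reducedDensity_le _ (((√p : ℝ) : ℂ)⁻¹ • P) Q ?_
      rw [Matrix.smul_mul, ← h]
      ext a c
      simp [div_eq_inv_mul]
    · rw [reducedDensity_div _ hp0, Matrix.trace_smul, trace_reducedDensity, ← hp, smul_eq_mul,
        ← Complex.ofReal_mul, inv_mul_cancel₀ h0.ne', Complex.ofReal_one]

theorem purity_eq {α β : Type*} [Fintype α] [Fintype β]
    (φ : α × β → ℂ) (P : Matrix α (Fin 2) ℂ) (Q : Matrix (Fin 2) β ℂ)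
    (h : (Matrix.of fun a c => φ (a, c)) = P * Q) {p : ℝ} (hp : p = ∑ a, ∑ c, ‖φ (a, c)‖ ^ 2)
    (h0 : 0 < p) :
    (reducedDensity (fun s => φ s / (√p : ℂ)) *
        reducedDensity (fun s => φ s / (√p : ℂ))).trace.re =
      1 - 2 * (((P.conjTranspose * P).det * (Q * Q.conjTranspose).det).re / p ^ 2) := by
  have ht := trace_reducedDensity φ
  rw [reducedDensity_eq_mul, h, ← hp] at ht
  rw [reducedDensity_div _ h0.le, reducedDensity_eq_mul, h, Matrix.smul_mul, Matrix.mul_smul,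
    smul_smul, Matrix.trace_smul, trace_sq_mul_factor, ht, smul_eq_mul, ← Complex.ofReal_mul,
    Complex.re_ofReal_mul]
  have e2 : ∀ z : ℂ, ((p : ℂ) ^ 2 - 2 * z).re = p ^ 2 - 2 * z.re := by
    intro z
    rw [Complex.sub_re, ← Complex.ofReal_pow, Complex.ofReal_re]
    simp
  rw [e2]
  field_simp

theorem re_det_mul_gram {α β : Type*} [Fintype α] [Fintype β]
    (P : Matrix α (Fin 2) ℂ) (M : Matrix (Fin 2) (Fin 2) ℂ) (R : Matrix (Fin 2) β ℂ) :
    ((P.conjTranspose * P).det * ((M * R) * (M * R).conjTranspose).det).re =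
      (P.conjTranspose * P).det.re * ‖M.det‖ ^ 2 * (R * R.conjTranspose).det.re := by
  have h1 := (Complex.nonneg_iff.1 (Matrix.posSemidef_conjTranspose_mul_self P).det_nonneg).2
  have h2 := (Complex.nonneg_iff.1 (Matrix.posSemidef_self_mul_conjTranspose R).det_nonneg).2
  have e : (M * R) * (M * R).conjTranspose = M * (R * R.conjTranspose) * M.conjTranspose := by
    rw [Matrix.conjTranspose_mul]
    simp only [Matrix.mul_assoc]
  rw [e, Matrix.det_mul, Matrix.det_mul, Matrix.det_conjTranspose]
  have e1 : (P.conjTranspose * P).det = (((P.conjTranspose * P).det.re : ℝ) : ℂ) :=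
    Complex.ext rfl (by simp [← h1])
  have e2 : (R * R.conjTranspose).det = (((R * R.conjTranspose).det.re : ℝ) : ℂ) :=
    Complex.ext rfl (by simp [← h2])
  have e3 : M.det * star M.det = ((‖M.det‖ ^ 2 : ℝ) : ℂ) := by
    rw [Complex.star_def, Complex.mul_conj, Complex.normSq_eq_norm_sq]
  rw [mul_right_comm M.det, e3, e1, e2, ← Complex.ofReal_mul, ← Complex.ofReal_mul,
    Complex.ofReal_re, Complex.ofReal_re, Complex.ofReal_re]
  ring

/-- The entropy is at most the concurrence, so that the probability-weighted entropy of a state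
`P * M * R` is at most a product of one factor for each of `P`, `M`, `R`; the weights of the
outcomes have cancelled. -/
theorem mul_entropy_le {α β : Type*} [Fintype α] [DecidableEq α] [Fintype β]
    (φ : α × β → ℂ) (P : Matrix α (Fin 2) ℂ) (M : Matrix (Fin 2) (Fin 2) ℂ)
    (R : Matrix (Fin 2) β ℂ) (h : (Matrix.of fun a c => φ (a, c)) = P * M * R) {p : ℝ}
    (hp : p = ∑ a, ∑ c, ‖φ (a, c)‖ ^ 2) :
    p * entanglementEntropy (fun s => φ s / (√p : ℂ)) ≤
      2 * (√(P.conjTranspose * P).det.re * ‖M.det‖ * √(R * R.conjTranspose).det.re) := by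
  have h' : (Matrix.of fun a c => φ (a, c)) = P * (M * R) := by rw [h, Matrix.mul_assoc]
  have hp0 : 0 ≤ p := by rw [hp]; positivity
  rcases hp0.eq_or_lt with h0 | h0
  · rw [← h0, zero_mul]
    positivity
  have d1 := (Complex.nonneg_iff.1 (Matrix.posSemidef_conjTranspose_mul_self P).det_nonneg).1
  have d2 := (Complex.nonneg_iff.1 (Matrix.posSemidef_self_mul_conjTranspose R).det_nonneg).1
  rw [mul_entropy_eq φ P (M * R) h' hp, purity_eq φ P (M * R) h' hp h0, re_det_mul_gram]
  set D := (P.conjTranspose * P).det.re * ‖M.det‖ ^ 2 * (R * R.conjTranspose).det.re with hD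
  have hD0 : 0 ≤ D := by positivity
  have hs : √D = √(P.conjTranspose * P).det.re * ‖M.det‖ * √(R * R.conjTranspose).det.re := by
    rw [hD, Real.sqrt_mul (by positivity), Real.sqrt_mul d1, Real.sqrt_sq (norm_nonneg _)]
  have hb : purityEntropy (1 - 2 * (D / p ^ 2)) ≤ 2 * √D / p := by
    refine (purityEntropy_le (by linarith [show 0 ≤ D / p ^ 2 by positivity])).trans_eq ?_
    rw [show 2 * (1 - (1 - 2 * (D / p ^ 2))) = (2 / p) ^ 2 * D by field_simp; ring,
      Real.sqrt_mul (by positivity), Real.sqrt_sq (by positivity)]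
    ring
  rw [← hs]
  calc p * purityEntropy (1 - 2 * (D / p ^ 2)) ≤ p * (2 * √D / p) :=
        mul_le_mul_of_nonneg_left hb hp0
    _ = 2 * √D := by field_simp

theorem mul_entropy_nonneg {α β : Type*} [Fintype α] [DecidableEq α] [Fintype β]
    (φ : α × β → ℂ) (P : Matrix α (Fin 2) ℂ) (M : Matrix (Fin 2) (Fin 2) ℂ)
    (R : Matrix (Fin 2) β ℂ) (h : (Matrix.of fun a c => φ (a, c)) = P * M * R) {p : ℝ}
    (hp : p = ∑ a, ∑ c, ‖φ (a, c)‖ ^ 2) :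
    0 ≤ p * entanglementEntropy (fun s => φ s / (√p : ℂ)) := by
  have h' : (Matrix.of fun a c => φ (a, c)) = P * (M * R) := by rw [h, Matrix.mul_assoc]
  have hp0 : 0 ≤ p := by rw [hp]; positivity
  rcases hp0.eq_or_lt with h0 | h0
  · rw [← h0, zero_mul]
  have d1 := (Complex.nonneg_iff.1 (Matrix.posSemidef_conjTranspose_mul_self P).det_nonneg).1
  have d2 := (Complex.nonneg_iff.1 (Matrix.posSemidef_self_mul_conjTranspose R).det_nonneg).1
  rw [mul_entropy_eq φ P (M * R) h' hp, purity_eq φ P (M * R) h' hp h0, re_det_mul_gram]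
  refine mul_nonneg hp0 (purityEntropy_nonneg ?_)
  have : 0 ≤ (P.conjTranspose * P).det.re * ‖M.det‖ ^ 2 * (R * R.conjTranspose).det.re / p ^ 2 := by
    positivity
  linarith

/-! ### The output state as a matrix product -/

/-- The row vector `f W₀ W₁ ⋯ W_{k-1}`. -/
def chainVec {R : Type*} [CommSemiring R] (f : Fin 2 → R) (W : ℕ → Matrix (Fin 2) (Fin 2) R) :
    ℕ → Fin 2 → R
  | 0 => f
  | k + 1 => Matrix.vecMul (chainVec f W k) (W k)

theorem chainVec_congr {R : Type*} [CommSemiring R] {f : Fin 2 → R}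
    {W W' : ℕ → Matrix (Fin 2) (Fin 2) R} {m : ℕ} (h : ∀ k < m, W k = W' k) :
    chainVec f W m = chainVec f W' m := by
  induction m with
  | zero => rfl
  | succ m ih => rw [chainVec, chainVec, ih fun k hk => h k (by omega), h m (by omega)]

/-- Summing the weights of all paths through a chain amounts to multiplying its matrices. -/
theorem sum_prod_eq_chainVec {R : Type*} [CommSemiring R] (f g : Fin 2 → R)
    (W : ℕ → Matrix (Fin 2) (Fin 2) R) (m : ℕ) :
    ∑ t : Fin (m + 1) → Fin 2,
      f (t 0) * (∏ k : Fin m, W k (t k.castSucc) (t k.succ)) * g (t (Fin.last m)) =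
      ∑ y, chainVec f W m y * g y := by
  induction m generalizing g with
  | zero =>
    refine Fintype.sum_equiv (Equiv.funUnique (Fin 1) (Fin 2)) _ _ fun t => ?_
    simp [chainVec]
  | succ m ih =>
    rw [← (Fin.snocEquiv fun _ => Fin 2).sum_comp, Fintype.sum_prod_type, Finset.sum_comm]
    have : ∀ t : Fin (m + 1) → Fin 2, ∑ x : Fin 2,
        f ((Fin.snocEquiv fun _ => Fin 2) (x, t) 0) * (∏ k : Fin (m + 1),
          W k ((Fin.snocEquiv fun _ => Fin 2) (x, t) k.castSucc)
            ((Fin.snocEquiv fun _ => Fin 2) (x, t) k.succ)) *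
          g ((Fin.snocEquiv fun _ => Fin 2) (x, t) (Fin.last (m + 1))) =
        f (t 0) * (∏ k : Fin m, W k (t k.castSucc) (t k.succ)) *
          (fun z => ∑ x, W m z x * g x) (t (Fin.last m)) := by
      intro t
      rw [Finset.mul_sum]
      refine Finset.sum_congr rfl fun x _ => ?_
      have h0 : (Fin.snoc t x : Fin (m + 2) → Fin 2) 0 = t 0 := Fin.snoc_castSucc (n := m + 1)
        (α := fun _ => Fin 2) x t 0
      have hs : ∀ k : Fin m, (Fin.snoc t x : Fin (m + 2) → Fin 2) k.castSucc.succ = t k.succ :=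
        fun k => Fin.snoc_castSucc (n := m + 1) (α := fun _ => Fin 2) x t k.succ
      rw [Fin.prod_univ_castSucc]
      simp only [Fin.snocEquiv, Equiv.coe_fn_mk, h0, hs, Fin.snoc_castSucc, Fin.snoc_last,
        Fin.succ_last, Fin.val_castSucc, Fin.val_last]
      ring
    refine (Finset.sum_congr rfl fun t _ => this t).trans ?_
    refine (ih fun z => ∑ x, W m z x * g x).trans ?_
    simp only [chainVec, Matrix.vecMul, dotProduct, Finset.sum_mul, Finset.mul_sum]
    rw [Finset.sum_comm]
    exact Finset.sum_congr rfl fun y _ => Finset.sum_congr rfl fun x _ => by ring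

/-- Applying gates on disjoint pairs of qubits: the gates contribute one matrix entry each, and the
untouched qubits keep their labels. -/
theorem foldl_applyGate {n : ℕ} (C : Circuit n) (φ : StateVec n) (l : List (Fin (n - 1)))
    (hl : l.Pairwise fun k k' : Fin (n - 1) => (k : ℕ) + 1 < k' ∨ (k' : ℕ) + 1 < k) (s : Fin n → Fin 2) :
    l.foldl (fun φ k => applyGate (C k) (leftQubit k) (rightQubit k) φ) φ s =
      ∑ t : Fin n → Fin 2,
        (l.map fun k => (C k : Matrix (Fin 2 × Fin 2) (Fin 2 × Fin 2) ℂ)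
          (s (leftQubit k), s (rightQubit k)) (t (leftQubit k), t (rightQubit k))).prod *
        (if ∀ q, (∀ k ∈ l, q ≠ leftQubit k ∧ q ≠ rightQubit k) → s q = t q then 1 else 0) *
        φ t := by
  induction l using List.reverseRecOn generalizing s with
  | nil => simp [← funext_iff]
  | append_singleton l k ih =>
    rw [List.pairwise_append] at hl
    obtain ⟨hl1, -, hl2⟩ := hl
    have hd : ∀ k' ∈ l, leftQubit k' ≠ leftQubit k ∧ leftQubit k' ≠ rightQubit k ∧
        rightQubit k' ≠ leftQubit k ∧ rightQubit k' ≠ rightQubit k := by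
      intro k' hk'
      have := hl2 k' hk' k (by simp)
      simp only [leftQubit, rightQubit, ne_eq, Fin.mk.injEq]
      omega
    have hLR : leftQubit k ≠ rightQubit k := by simp [leftQubit, rightQubit]
    rw [List.foldl_append, List.foldl_cons, List.foldl_nil, applyGate]
    simp only [ih hl1, Finset.mul_sum]
    rw [Finset.sum_comm]
    refine Finset.sum_congr rfl fun t _ => ?_
    have hprod : ∀ u : Fin 2 × Fin 2, ∀ k' ∈ l,
        (C k' : Matrix (Fin 2 × Fin 2) (Fin 2 × Fin 2) ℂ)
          (Function.update (Function.update s (leftQubit k) u.1) (rightQubit k) u.2 (leftQubit k'),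
            Function.update (Function.update s (leftQubit k) u.1) (rightQubit k) u.2 (rightQubit k'))
          (t (leftQubit k'), t (rightQubit k')) =
        (C k' : Matrix (Fin 2 × Fin 2) (Fin 2 × Fin 2) ℂ)
          (s (leftQubit k'), s (rightQubit k')) (t (leftQubit k'), t (rightQubit k')) := by
      intro u k' hk'
      obtain ⟨h1, h2, h3, h4⟩ := hd k' hk'
      simp [Function.update_of_ne, h1, h2, h3, h4]
    have hcond : ∀ u : Fin 2 × Fin 2,
        (∀ q, (∀ k' ∈ l, q ≠ leftQubit k' ∧ q ≠ rightQubit k') →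
          Function.update (Function.update s (leftQubit k) u.1) (rightQubit k) u.2 q = t q) ↔
        u = (t (leftQubit k), t (rightQubit k)) ∧
          ∀ q, (∀ k' ∈ l ++ [k], q ≠ leftQubit k' ∧ q ≠ rightQubit k') → s q = t q := by
      intro u
      constructor
      · intro h
        refine ⟨Prod.ext ?_ ?_, fun q hq => ?_⟩
        · have := h (leftQubit k) fun k' hk' => ⟨(hd k' hk').1.symm, (hd k' hk').2.2.1.symm⟩
          rwa [Function.update_of_ne hLR, Function.update_self] at this
        · have := h (rightQubit k) fun k' hk' => ⟨(hd k' hk').2.1.symm, (hd k' hk').2.2.2.symm⟩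
          rwa [Function.update_self] at this
        · have h1 := hq k (by simp)
          have := h q fun k' hk' => hq k' (by simp [hk'])
          rwa [Function.update_of_ne h1.2, Function.update_of_ne h1.1] at this
      · rintro ⟨rfl, h⟩ q hq
        by_cases h1 : q = rightQubit k
        · rw [h1, Function.update_self]
        · rw [Function.update_of_ne h1]
          by_cases h2 : q = leftQubit k
          · rw [h2, Function.update_self]
          · rw [Function.update_of_ne h2]
            refine h q fun k' hk' => ?_
            rcases List.mem_append.1 hk' with hk' | hk'
            · exact hq k' hk'
            · rw [List.mem_singleton.1 hk']
              exact ⟨h2, h1⟩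
    rw [Finset.sum_eq_single (t (leftQubit k), t (rightQubit k))]
    · rw [List.map_congr_left (hprod _), if_congr (hcond _) rfl rfl]
      simp only [true_and, List.map_append, List.prod_append, List.map_cons, List.map_nil,
        List.prod_cons, List.prod_nil]
      ring
    · intro u _ hu
      rw [if_neg fun h => hu ((hcond u).1 h).1]
      ring
    · simp

theorem applyLayer_apply {n : ℕ} (p : Fin (n - 1) → Prop) [DecidablePred p]
    (hp : ∀ k k', p k → p k' → k < k' → (k : ℕ) + 1 < k') (C : Circuit n) (φ : StateVec n)
    (s : Fin n → Fin 2) :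
    applyLayer p C φ s = ∑ t : Fin n → Fin 2,
      (∏ k, if p k then (C k : Matrix (Fin 2 × Fin 2) (Fin 2 × Fin 2) ℂ)
          (s (leftQubit k), s (rightQubit k)) (t (leftQubit k), t (rightQubit k)) else 1) *
        (if ∀ q, (∀ k, p k → q ≠ leftQubit k ∧ q ≠ rightQubit k) → s q = t q then 1 else 0) *
        φ t := by
  rw [applyLayer, foldl_applyGate]
  · refine Finset.sum_congr rfl fun t _ => ?_
    congr 2
    · rw [← List.prod_toFinset _ ((List.nodup_finRange _).filter _), ← Finset.prod_filter]
      congr 1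
      ext k
      simp
    · simp
  · refine List.Pairwise.imp_of_mem ?_ ((List.pairwise_lt_finRange (n - 1)).filter _)
    intro k k' hk hk' hlt
    simp only [List.mem_filter, decide_eq_true_eq] at hk hk'
    exact Or.inl (hp k k' hk.2 hk'.2 hlt)

/-- The gate of the pair `k`, with a default value beyond the last pair. -/
def gateAt {n : ℕ} (C : Circuit n) (k : ℕ) : Gate := if h : k < n - 1 then C ⟨k, h⟩ else 1

/-- The label of the qubit `k`, with a default value beyond the last qubit. -/
def labelAt {n : ℕ} (s : Fin n → Fin 2) (k : ℕ) : Fin 2 := if h : k < n then s ⟨k, h⟩ else 0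

/-- The state, as a matrix of amplitudes, that a gate creates from `|00⟩`. -/
def prepMatrix (U : Gate) : Matrix (Fin 2) (Fin 2) ℂ :=
  Matrix.of fun x y => (U : Matrix (Fin 2 × Fin 2) (Fin 2 × Fin 2) ℂ) (x, y) (0, 0)

/-- The row of a gate that belongs to the output labels `u`, `v`, as a matrix in the input labels. -/
def measMatrix (U : Gate) (u v : Fin 2) : Matrix (Fin 2) (Fin 2) ℂ :=
  Matrix.of fun x y => (U : Matrix (Fin 2 × Fin 2) (Fin 2 × Fin 2) ℂ) (u, v) (x, y)

/-- The matrix of the gate on the pair `k` in the matrix product. The row and column indices are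
the labels of the qubits `k` and `k + 1` between the two layers, and `u`, `v` are their labels in
the output. Gates with even `k` belong to the first layer and do not see the output labels. -/
def link (U : Gate) (k : ℕ) (u v : Fin 2) : Matrix (Fin 2) (Fin 2) ℂ :=
  if Even k then prepMatrix U else measMatrix U u v

/-- The boundary vector at the last qubit `m`, which misses the first layer if `m` is even and the
second layer if `m` is odd. -/
def endVec (m : ℕ) (u : Fin 2) : Fin 2 → ℂ := if Even m then Pi.single 0 1 else Pi.single u 1

theorem untouched_second_layer {m : ℕ} (s t : Fin (m + 1) → Fin 2) :
    (∀ q, (∀ k : Fin (m + 1 - 1), Even ((k : ℕ) + 1) → q ≠ leftQubit k ∧ q ≠ rightQubit k) →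
      s q = t q) ↔ s 0 = t 0 ∧ (¬ Even m → s (Fin.last m) = t (Fin.last m)) := by
  constructor
  · intro h
    refine ⟨h 0 fun k hk => ?_, fun hm => h _ fun k hk => ?_⟩
    · simp only [leftQubit, rightQubit, ne_eq, Fin.ext_iff, Fin.val_zero]
      rw [Nat.even_iff] at hk
      omega
    · have := k.2
      simp only [leftQubit, rightQubit, ne_eq, Fin.ext_iff, Fin.val_last]
      rw [Nat.even_iff] at hk hm
      omega
  · rintro ⟨h0, h1⟩ q hq
    by_cases hq0 : q = 0
    · rw [hq0, h0]
    have hq0' : (q : ℕ) ≠ 0 := fun h => hq0 (Fin.ext h)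
    have hqm := q.2
    by_cases hev : Even (q : ℕ)
    · have := (hq ⟨q - 1, by omega⟩ (by
        rw [Nat.even_iff] at hev ⊢
        simp only
        omega)).2
      refine absurd (Fin.ext ?_) this
      simp only [rightQubit]
      omega
    · by_cases hl : (q : ℕ) = m
      · have e : q = Fin.last m := Fin.ext hl
        rw [e]
        exact h1 (by rwa [hl] at hev)
      · have := (hq ⟨q, by omega⟩ (by
          rw [Nat.even_iff] at hev ⊢
          simp only
          omega)).1
        exact absurd (Fin.ext rfl) this

theorem untouched_first_layer {m : ℕ} (t : Fin (m + 1) → Fin 2) :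
    (∀ q, (∀ k : Fin (m + 1 - 1), Odd ((k : ℕ) + 1) → q ≠ leftQubit k ∧ q ≠ rightQubit k) →
      t q = (0 : Fin (m + 1) → Fin 2) q) ↔ (Even m → t (Fin.last m) = 0) := by
  constructor
  · intro h hm
    refine h _ fun k hk => ?_
    have := k.2
    simp only [leftQubit, rightQubit, ne_eq, Fin.ext_iff, Fin.val_last]
    rw [Nat.even_iff] at hm
    rw [Nat.odd_iff] at hk
    omega
  · intro h1 q hq
    have hqm := q.2
    by_cases hev : Even (q : ℕ)
    · by_cases hl : (q : ℕ) = m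
      · have e : q = Fin.last m := Fin.ext hl
        rw [e]
        exact h1 (by rwa [hl] at hev)
      · have := (hq ⟨q, by omega⟩ hev.add_one).1
        exact absurd (Fin.ext rfl) this
    · have h0 : (q : ℕ) ≠ 0 := fun h => hev (by simp [h])
      have := (hq ⟨q - 1, by omega⟩ (by
        rw [Nat.even_iff] at hev
        rw [Nat.odd_iff]
        simp only
        omega)).2
      refine absurd (Fin.ext ?_) this
      simp only [rightQubit]
      omega

/-- The output amplitudes are given by a product of `2 × 2` matrices, one for each gate of either
layer. -/
theorem outputState_eq_chainVec {m : ℕ} (C : Circuit (m + 1)) (s : Fin (m + 1) → Fin 2) :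
    outputState C s = ∑ y, chainVec (Pi.single (labelAt s 0) 1)
      (fun k => link (gateAt C k) k (labelAt s k) (labelAt s (k + 1))) m y *
        endVec m (labelAt s m) y := by
  set W : ℕ → Matrix (Fin 2) (Fin 2) ℂ :=
    fun k => link (gateAt C k) k (labelAt s k) (labelAt s (k + 1)) with hW
  have h0 : labelAt s 0 = s 0 := by simp [labelAt]
  have hm : labelAt s m = s (Fin.last m) := by simp [labelAt, Fin.last]
  rw [← sum_prod_eq_chainVec, outputState, applyLayer_apply]
  · refine Finset.sum_congr rfl fun t _ => ?_
    rw [applyLayer_apply, Finset.sum_eq_single 0, if_congr (untouched_second_layer s t) rfl rfl,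
      if_congr (untouched_first_layer t) rfl rfl]
    · have hz : zeroState (m + 1) 0 = 1 := by simp [zeroState]
      have hprod : (∏ k : Fin (m + 1 - 1), if Even ((k : ℕ) + 1) then
            (C k : Matrix (Fin 2 × Fin 2) (Fin 2 × Fin 2) ℂ)
              (s (leftQubit k), s (rightQubit k)) (t (leftQubit k), t (rightQubit k)) else 1) *
          (∏ k : Fin (m + 1 - 1), if Odd ((k : ℕ) + 1) then
            (C k : Matrix (Fin 2 × Fin 2) (Fin 2 × Fin 2) ℂ)
              (t (leftQubit k), t (rightQubit k)) (0, 0) else 1) =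
          ∏ k : Fin m, W k (t k.castSucc) (t k.succ) := by
        rw [← Finset.prod_mul_distrib]
        refine Finset.prod_congr rfl fun k _ => ?_
        have hk := k.2
        have e1 : gateAt C k = C k := by simp [gateAt]
        have e2 : labelAt s k = s (leftQubit k) := by
          rw [labelAt, dif_pos (by omega)]; rfl
        have e3 : labelAt s (k + 1) = s (rightQubit k) := by
          rw [labelAt, dif_pos (by omega)]; rfl
        simp only [hW, link, e1, e2, e3]
        by_cases hev : Even (k : ℕ)
        · rw [if_neg (by simpa [Nat.even_add_one] using hev), if_pos hev.add_one, if_pos hev, one_mul]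
          rfl
        · rw [if_pos (by simpa [Nat.even_add_one] using hev), if_neg (by
            simpa [Nat.odd_add_one] using hev), if_neg hev, mul_one]
          rfl
      rw [← hprod, hz, h0, hm]
      simp only [Pi.zero_apply, endVec]
      by_cases ha : s 0 = t 0 <;> by_cases hev : Even m
      · by_cases hb : t (Fin.last m) = 0 <;> simp [ha, hev, hb]
      · by_cases hb : s (Fin.last m) = t (Fin.last m)
        · simp [ha, hev, hb]
        · simp [ha, hev, hb, Ne.symm hb]
      · simp [ha, Ne.symm ha]
      · simp [ha, Ne.symm ha]
    · intro t' _ ht'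
      simp [zeroState, ht']
    · simp
    · intro k k' hk hk' hlt
      rw [Nat.odd_iff] at hk hk'
      rw [Fin.lt_def] at hlt
      omega
  · intro k k' hk hk' hlt
    rw [Nat.even_iff] at hk hk'
    rw [Fin.lt_def] at hlt
    omega

theorem chainVec_add {R : Type*} [CommSemiring R] (f : Fin 2 → R)
    (W : ℕ → Matrix (Fin 2) (Fin 2) R) (i p : ℕ) :
    chainVec f W (i + p) =
      Matrix.vecMul (chainVec f W i) ((List.range p).map fun k => W (i + k)).prod := by
  induction p with
  | zero => simp
  | succ p ih =>
    rw [← add_assoc, chainVec, ih, Matrix.vecMul_vecMul, List.range_succ, List.map_append,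
      List.prod_append]
    simp

/-- The chain may be contracted from both ends and joined at any site `q`. -/
theorem sum_chainVec_split {R : Type*} [CommSemiring R] (f g : Fin 2 → R)
    (W : ℕ → Matrix (Fin 2) (Fin 2) R) {m d : ℕ} (hd : d ≤ m) :
    ∑ y, chainVec f W m y * g y =
      ∑ y, chainVec f W (m - d) y * chainVec g (fun k => (W (m - 1 - k)).transpose) d y := by
  induction d with
  | zero => rfl
  | succ d ih =>
    rw [ih (by omega)]
    obtain ⟨e, he⟩ : ∃ e, m - d = e + 1 := ⟨m - d - 1, by omega⟩
    have h1 : m - (d + 1) = e := by omega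
    have h2 : m - 1 - d = e := by omega
    rw [he, h1]
    simp only [chainVec, h2]
    rw [Matrix.vecMul_transpose]
    exact Matrix.dotProduct_mulVec _ _ _ |>.symm

/-! ### Gram matrices of the two ends of the chain -/

/-- The Gram matrices of the vectors `init (s 0) T₀(s 0, s 1) ⋯ T_{q-1}(s (q-1), s q)`, summed over
the labels `s 0, …, s (q - 1)`, as a function of the last label `s q`. -/
def gram (init : Fin 2 → Fin 2 → ℂ) (T : ℕ → Fin 2 → Fin 2 → Matrix (Fin 2) (Fin 2) ℂ) :
    ℕ → Fin 2 → Matrix (Fin 2) (Fin 2) ℂ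
  | 0, v => Matrix.vecMulVec (star (init v)) (init v)
  | q + 1, v => ∑ u, (T q u v).conjTranspose * gram init T q u * T q u v

theorem gram_posSemidef (init : Fin 2 → Fin 2 → ℂ)
    (T : ℕ → Fin 2 → Fin 2 → Matrix (Fin 2) (Fin 2) ℂ) (q : ℕ) (v : Fin 2) :
    (gram init T q v).PosSemidef := by
  induction q generalizing v with
  | zero => exact Matrix.posSemidef_vecMulVec_star_self _
  | succ q ih =>
    exact Matrix.posSemidef_sum _ fun u _ => (ih u).conjTranspose_mul_mul_same _

theorem gram_eq_sum (init : Fin 2 → Fin 2 → ℂ)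
    (T : ℕ → Fin 2 → Fin 2 → Matrix (Fin 2) (Fin 2) ℂ) (q : ℕ) (v x y : Fin 2)
    (s : (Fin q → Fin 2) → ℕ → Fin 2) (hs : ∀ a (k : Fin q), s a k = a k) (hv : ∀ a, s a q = v) :
    gram init T q v x y = ∑ a : Fin q → Fin 2,
      star (chainVec (init (s a 0)) (fun k => T k (s a k) (s a (k + 1))) q x) *
        chainVec (init (s a 0)) (fun k => T k (s a k) (s a (k + 1))) q y := by
  induction q generalizing v x y with
  | zero =>
    simp [gram, chainVec, Matrix.vecMulVec_apply, hv]
  | succ q ih =>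
    rw [← (Fin.snocEquiv fun _ => Fin 2).sum_comp, Fintype.sum_prod_type, gram, Matrix.sum_apply]
    refine Finset.sum_congr rfl fun u _ => ?_
    have hk : ∀ (a : Fin q → Fin 2) (k : Fin q), s (Fin.snoc a u) k = a k := by
      intro a k
      have := hs (Fin.snoc a u) k.castSucc
      rwa [Fin.val_castSucc, Fin.snoc_castSucc (α := fun _ => Fin 2)] at this
    have hq : ∀ a : Fin q → Fin 2, s (Fin.snoc a u) q = u := by
      intro a
      have := hs (Fin.snoc a u) (Fin.last q)
      rwa [Fin.val_last, Fin.snoc_last (α := fun _ => Fin 2)] at this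
    have ih' := fun x y => ih u x y (fun a => s (Fin.snoc a u)) hk hq
    simp only [Fin.snocEquiv, Equiv.coe_fn_mk, chainVec, hq, hv, Matrix.mul_apply,
      Matrix.conjTranspose_apply, ih', Matrix.vecMul, dotProduct, star_sum, star_mul',
      Finset.sum_mul, Finset.mul_sum]
    rw [Finset.sum_comm]
    simp only [Fin.sum_univ_two, ← Finset.sum_add_distrib]
    refine Finset.sum_congr rfl fun a _ => ?_
    ring

theorem two_mul_sqrt_det_le_trace {H : Matrix (Fin 2) (Fin 2) ℂ} (hH : H.PosSemidef) :
    2 * √H.det.re ≤ H.trace.re := by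
  have h0 := Complex.nonneg_iff.1 (hH.diag_nonneg (i := 0))
  have h1 := Complex.nonneg_iff.1 (hH.diag_nonneg (i := 1))
  have h01 : H 0 1 = star (H 1 0) := (hH.1.apply 0 1).symm
  have hd : H.det.re ≤ (H 0 0).re * (H 1 1).re := by
    rw [Matrix.det_fin_two, h01]
    simp only [Complex.sub_re, Complex.mul_re, Complex.star_def, Complex.conj_re, Complex.conj_im,
      ← h0.2, ← h1.2]
    nlinarith [sq_nonneg (H 1 0).re, sq_nonneg (H 1 0).im]
  have ht : H.trace.re = (H 0 0).re + (H 1 1).re := by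
    simp [Matrix.trace, Fin.sum_univ_two]
  rw [ht]
  have h2 : √H.det.re ≤ ((H 0 0).re + (H 1 1).re) / 2 := by
    refine Real.sqrt_le_iff.2 ⟨by linarith [h0.1, h1.1], hd.trans ?_⟩
    nlinarith [sq_nonneg ((H 0 0).re - (H 1 1).re)]
  linarith

/-- The matrices `V u v` are the blocks of an isometry whose input is the pair of their indices and
whose output is the pair `(u, v)`. -/
def IsIsometryFamily (V : Fin 2 → Fin 2 → Matrix (Fin 2) (Fin 2) ℂ) : Prop :=
  ∀ x y x' y', ∑ u, ∑ v, star (V u v x y) * V u v x' y' = if x = x' ∧ y = y' then 1 else 0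

theorem gate_column_orthonormal (U : Gate) (z z' : Fin 2 × Fin 2) :
    ∑ w, star ((U : Matrix (Fin 2 × Fin 2) (Fin 2 × Fin 2) ℂ) w z) *
      (U : Matrix (Fin 2 × Fin 2) (Fin 2 × Fin 2) ℂ) w z' = if z = z' then 1 else 0 := by
  have h := congrFun (congrFun (Matrix.mem_unitaryGroup_iff'.1 U.2) z) z'
  rwa [Matrix.mul_apply, Matrix.one_apply] at h

theorem isIsometryFamily_measMatrix (U : Gate) : IsIsometryFamily (measMatrix U) := by
  intro x y x' y'
  have h := gate_column_orthonormal U (x, y) (x', y')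
  rw [Fintype.sum_prod_type] at h
  simpa [measMatrix, Prod.ext_iff] using h

theorem IsIsometryFamily.reverse {V : Fin 2 → Fin 2 → Matrix (Fin 2) (Fin 2) ℂ}
    (h : IsIsometryFamily V) : IsIsometryFamily fun u v => (V v u).transpose := by
  intro x y x' y'
  have := h y x y' x'
  rw [Finset.sum_comm] at this
  simpa [and_comm] using this

theorem trace_prepMatrix (U : Gate) :
    ((prepMatrix U).conjTranspose * prepMatrix U).trace = 1 := by
  have h := gate_column_orthonormal U (0, 0) (0, 0)
  rw [Fintype.sum_prod_type, Finset.sum_comm] at h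
  simpa [Matrix.trace, Matrix.mul_apply, prepMatrix] using h

theorem trace_transpose_prepMatrix (U : Gate) :
    ((prepMatrix U).transpose.conjTranspose * (prepMatrix U).transpose).trace = 1 := by
  have h := gate_column_orthonormal U (0, 0) (0, 0)
  rw [Fintype.sum_prod_type] at h
  simpa [Matrix.trace, Matrix.mul_apply, prepMatrix] using h

theorem gram_succ_of_const {init : Fin 2 → Fin 2 → ℂ}
    {T : ℕ → Fin 2 → Fin 2 → Matrix (Fin 2) (Fin 2) ℂ} {q : ℕ}
    (h : ∑ u, gram init T q u = 1) {F : Matrix (Fin 2) (Fin 2) ℂ} (hF : ∀ u v, T q u v = F)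
    (v : Fin 2) : gram init T (q + 1) v = F.conjTranspose * F := by
  simp only [gram, hF]
  rw [← Finset.sum_mul, ← Finset.mul_sum, h, mul_one]

theorem sum_gram_succ_of_isometry {init : Fin 2 → Fin 2 → ℂ}
    {T : ℕ → Fin 2 → Fin 2 → Matrix (Fin 2) (Fin 2) ℂ} {q : ℕ}
    {H : Matrix (Fin 2) (Fin 2) ℂ} (h : ∀ u, gram init T q u = H) (ht : H.trace = 1)
    (hT : IsIsometryFamily (T q)) : ∑ v, gram init T (q + 1) v = 1 := by
  ext y y'
  have e : ∀ x x', ∑ u, ∑ v, star (T q u v x y) * H x x' * T q u v x' y' =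
      if x = x' ∧ y = y' then H x x' else 0 := by
    intro x x'
    rw [← mul_one (H x x'), ← mul_zero (H x x'), ← mul_ite, ← hT x y x' y', Finset.mul_sum]
    refine Finset.sum_congr rfl fun u _ => ?_
    rw [Finset.mul_sum]
    exact Finset.sum_congr rfl fun v _ => by ring
  have e' : ∑ v, gram init T (q + 1) v y y' =
      ∑ x, ∑ x', ∑ u, ∑ v, star (T q u v x y) * H x x' * T q u v x' y' := by
    simp only [gram, h, Matrix.sum_apply, Matrix.mul_apply, Matrix.conjTranspose_apply,
      Fin.sum_univ_two]
    ring
  rw [Matrix.sum_apply, e']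
  simp only [e, Matrix.one_apply]
  have ht' : H 0 0 + H 1 1 = 1 := by simpa [Matrix.trace, Fin.sum_univ_two] using ht
  by_cases hy : y = y' <;> simp [hy, Fin.sum_univ_two, ht']

/-- Along a chain that alternates between state preparations and isometries, the Gram matrices
alternate between resolutions of the identity and constant matrices of trace one. The predicate `A`
selects the sites of the former kind. -/
theorem gram_alternating {init : Fin 2 → Fin 2 → ℂ}
    {T : ℕ → Fin 2 → Fin 2 → Matrix (Fin 2) (Fin 2) ℂ} {A : ℕ → Prop} {N : ℕ}
    (h0 : A 0 → ∑ u, gram init T 0 u = 1)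
    (h0' : ¬ A 0 → ∃ H, H.trace = 1 ∧ ∀ u, gram init T 0 u = H)
    (h1 : ∀ k < N, A k → ¬ A (k + 1) ∧
      ∃ F, (∀ u v, T k u v = F) ∧ (F.conjTranspose * F).trace = 1)
    (h2 : ∀ k < N, ¬ A k → A (k + 1) ∧ IsIsometryFamily (T k)) {q : ℕ} (hq : q ≤ N) :
    (A q → ∑ u, gram init T q u = 1) ∧
      (¬ A q → ∃ H, H.trace = 1 ∧ ∀ u, gram init T q u = H) := by
  induction q with
  | zero => exact ⟨h0, h0'⟩
  | succ q ih =>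
    obtain ⟨ih1, ih2⟩ := ih (by omega)
    by_cases hA : A q
    · obtain ⟨hn, F, hF, ht⟩ := h1 q (by omega) hA
      exact ⟨fun h => absurd h hn, fun _ => ⟨_, ht, gram_succ_of_const (ih1 hA) hF⟩⟩
    · obtain ⟨hn, hT⟩ := h2 q (by omega) hA
      obtain ⟨H, ht, hH⟩ := ih2 hA
      exact ⟨fun _ => sum_gram_succ_of_isometry hH ht hT, fun h => absurd hn h⟩

theorem sum_sqrt_det_gram_le {init : Fin 2 → Fin 2 → ℂ}
    {T : ℕ → Fin 2 → Fin 2 → Matrix (Fin 2) (Fin 2) ℂ} {q : ℕ}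
    (h : ∑ u, gram init T q u = 1) : ∑ u, √(gram init T q u).det.re ≤ 1 := by
  have h1 : ∑ u, 2 * √(gram init T q u).det.re ≤ ∑ u, (gram init T q u).trace.re :=
    Finset.sum_le_sum fun u _ => two_mul_sqrt_det_le_trace (gram_posSemidef init T q u)
  rw [← Complex.re_sum, ← Matrix.trace_sum, h, ← Finset.mul_sum] at h1
  simpa [Matrix.trace_one] using h1

theorem sqrt_det_conjTranspose_mul_self (F : Matrix (Fin 2) (Fin 2) ℂ) :
    √(F.conjTranspose * F).det.re = ‖F.det‖ := by
  rw [Matrix.det_mul, Matrix.det_conjTranspose, Complex.star_def, mul_comm, Complex.mul_conj,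
    Complex.ofReal_re, Complex.normSq_eq_norm_sq, Real.sqrt_sq (norm_nonneg _)]

/-- The concurrence of the two-qubit state that a gate creates from `|00⟩`. -/
def concurrence (U : Gate) : ℝ := 2 * ‖(prepMatrix U).det‖

theorem concurrence_nonneg (U : Gate) : 0 ≤ concurrence U := by
  unfold concurrence
  positivity

theorem concurrence_le_one (U : Gate) : concurrence U ≤ 1 := by
  have h := two_mul_sqrt_det_le_trace (Matrix.posSemidef_conjTranspose_mul_self (prepMatrix U))
  rwa [sqrt_det_conjTranspose_mul_self, trace_prepMatrix, Complex.one_re] at h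

theorem det_vecMulVec_eq_zero (f g : Fin 2 → ℂ) : (Matrix.vecMulVec f g).det = 0 := by
  simp [Matrix.det_fin_two, Matrix.vecMulVec_apply]
  ring

/-- The concurrence of the pair `k`, which is `0` if there is no such pair. -/
def concurrenceAt {n : ℕ} (C : Circuit n) (k : ℕ) : ℝ :=
  if k < n - 1 then concurrence (gateAt C k) else 0

theorem concurrenceAt_nonneg {n : ℕ} (C : Circuit n) (k : ℕ) : 0 ≤ concurrenceAt C k := by
  unfold concurrenceAt
  split_ifs
  exacts [concurrence_nonneg _, le_rfl]

theorem sum_gram_zero_single {T : ℕ → Fin 2 → Fin 2 → Matrix (Fin 2) (Fin 2) ℂ} :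
    ∑ u, gram (fun u => Pi.single u 1) T 0 u = 1 := by
  ext x y
  fin_cases x <;> fin_cases y <;> simp [gram, Matrix.vecMulVec_apply, Fin.sum_univ_two]

/-- The Gram matrices of the part of the chain to the left of the qubit `q`. -/
def leftGram {n : ℕ} (C : Circuit n) : ℕ → Fin 2 → Matrix (Fin 2) (Fin 2) ℂ :=
  gram (fun u => Pi.single u 1) fun k => link (gateAt C k) k

/-- The Gram matrices of the part of the chain to the right of the qubit `m - q`, where `m` is the
last qubit. -/
def rightGram {m : ℕ} (C : Circuit (m + 1)) : ℕ → Fin 2 → Matrix (Fin 2) (Fin 2) ℂ :=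
  gram (endVec m) fun k u v => (link (gateAt C (m - 1 - k)) (m - 1 - k) v u).transpose

theorem sum_leftGram {n : ℕ} (C : Circuit n) {q : ℕ} (hq : Even q) : ∑ u, leftGram C q u = 1 := by
  refine (gram_alternating (A := Even) (N := q) (fun _ => sum_gram_zero_single)
    (fun h => absurd Even.zero h) (fun k _ hk => ?_) (fun k _ hk => ?_) le_rfl).1 hq
  · refine ⟨by simpa [Nat.even_add_one] using hk, prepMatrix (gateAt C k), fun u v => ?_,
      trace_prepMatrix _⟩
    simp [link, hk]
  · refine ⟨by simpa [Nat.even_add_one] using hk, ?_⟩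
    convert isIsometryFamily_measMatrix (gateAt C k) using 1
    ext u v
    simp [link, hk]

theorem sum_sqrt_leftGram_le {n : ℕ} (C : Circuit n) {q : ℕ} (hq : Even q) :
    ∑ u, √(leftGram C q u).det.re ≤ 1 :=
  sum_sqrt_det_gram_le (sum_leftGram C hq)

theorem sqrt_leftGram_eq {n : ℕ} (C : Circuit n) {q : ℕ} (hq : Even q) (hqn : q < n - 1)
    (u : Fin 2) : √(leftGram C (q + 1) u).det.re = concurrenceAt C q / 2 := by
  have h := gram_succ_of_const (sum_leftGram C hq) (F := prepMatrix (gateAt C q))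
    (fun u v => by simp [link, hq]) u
  rw [leftGram, h, sqrt_det_conjTranspose_mul_self, concurrenceAt, if_pos hqn, concurrence]
  ring

theorem sum_rightGram {m : ℕ} (C : Circuit (m + 1)) {q : ℕ} (hqm : q ≤ m) (hq : ¬ Even (m - q)) :
    ∑ u, rightGram C q u = 1 := by
  refine (gram_alternating (A := fun k => ¬ Even (m - k)) (N := q) (fun h => ?_)
    (fun h => ?_) (fun k hkq hk => ?_) (fun k hkq hk => ?_) le_rfl).1 hq
  · have e : endVec m = fun u => Pi.single u 1 := by
      funext u
      rw [endVec, if_neg (by simpa using h)]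
    rw [e]
    exact sum_gram_zero_single
  · refine ⟨Matrix.vecMulVec (star (Pi.single 0 1)) (Pi.single 0 1), ?_, fun u => ?_⟩
    · simp [Matrix.trace, Matrix.vecMulVec_apply]
    · rw [gram, endVec, if_pos (by simpa using h)]
  · have hp : m - k = m - 1 - k + 1 := by omega
    rw [hp, Nat.even_add_one, not_not] at hk
    have hp' : m - (k + 1) = m - 1 - k := by omega
    refine ⟨by rwa [hp', not_not], (prepMatrix (gateAt C (m - 1 - k))).transpose, fun u v => ?_,
      trace_transpose_prepMatrix _⟩
    simp [link, hk]
  · have hp : m - k = m - 1 - k + 1 := by omega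
    rw [not_not, hp, Nat.even_add_one] at hk
    have hp' : m - (k + 1) = m - 1 - k := by omega
    refine ⟨by rwa [hp'], ?_⟩
    convert (isIsometryFamily_measMatrix (gateAt C (m - 1 - k))).reverse using 1
    ext u v
    simp [link, hk]

theorem sum_sqrt_rightGram_le {m : ℕ} (C : Circuit (m + 1)) {j : ℕ} (hjm : j ≤ m)
    (hj : ¬ Even j) : ∑ u, √(rightGram C (m - j) u).det.re ≤ 1 :=
  sum_sqrt_det_gram_le (sum_rightGram C (Nat.sub_le _ _) (by rwa [Nat.sub_sub_self hjm]))

theorem sqrt_rightGram_eq {m : ℕ} (C : Circuit (m + 1)) {j : ℕ} (hjm : j ≤ m) (hj : Even j)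
    (u : Fin 2) : √(rightGram C (m - j) u).det.re = concurrenceAt C j / 2 := by
  rcases hjm.eq_or_lt with rfl | hlt
  · rw [Nat.sub_self, rightGram, gram, det_vecMulVec_eq_zero, concurrenceAt, if_neg (by omega)]
    simp
  · obtain ⟨q, hq⟩ : ∃ q, m - j = q + 1 := ⟨m - j - 1, by omega⟩
    have hj' : m - 1 - q = j := by omega
    have h := gram_succ_of_const (sum_rightGram C (q := q) (by omega)
      (by rwa [show m - q = j + 1 by omega, Nat.even_add_one, not_not]))
      (F := (prepMatrix (gateAt C j)).transpose) (fun u v => by simp [link, hj, hj']) u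
    rw [hq, rightGram, h, sqrt_det_conjTranspose_mul_self, Matrix.det_transpose, concurrenceAt,
      if_pos (by omega), concurrence]
    ring

/-! ### The post-measurement states -/

theorem labelAt_glue_left {n : ℕ} {i j : Fin n} (a : LeftConf i) (b : BlockConf i j)
    (c : RightConf j) {k : ℕ} (hk : k < i) :
    labelAt (glue a b c) k = a ⟨⟨k, hk.trans i.2⟩, hk⟩ := by
  have : (⟨k, hk.trans i.2⟩ : Fin n) < i := hk
  rw [labelAt, dif_pos (hk.trans i.2), glue, dif_pos this]

/-- The label of the qubit `k` in the block, with a default value outside it. -/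
def blockAt {n : ℕ} {i j : Fin n} (b : BlockConf i j) (k : ℕ) : Fin 2 :=
  if h : (i : ℕ) ≤ k ∧ k ≤ j then b ⟨⟨k, h.2.trans_lt j.2⟩, h⟩ else 0

theorem labelAt_glue_block {n : ℕ} {i j : Fin n} (a : LeftConf i) (b : BlockConf i j)
    (c : RightConf j) {k : ℕ} (h1 : (i : ℕ) ≤ k) (h2 : k ≤ j) :
    labelAt (glue a b c) k = blockAt b k := by
  have e1 : ¬ (⟨k, h2.trans_lt j.2⟩ : Fin n) < i := not_lt.2 h1
  have e2 : (⟨k, h2.trans_lt j.2⟩ : Fin n) ≤ j := h2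
  rw [labelAt, dif_pos (h2.trans_lt j.2), glue, dif_neg e1, dif_pos e2, blockAt, dif_pos ⟨h1, h2⟩]

theorem labelAt_glue_right {n : ℕ} {i j : Fin n} (hij : i ≤ j) (a : LeftConf i)
    (b : BlockConf i j) (c : RightConf j) {k : ℕ} (hk : (j : ℕ) < k) (hkn : k < n) :
    labelAt (glue a b c) k = c ⟨⟨k, hkn⟩, hk⟩ := by
  have e1 : ¬ (⟨k, hkn⟩ : Fin n) < i := not_lt.2 (hij.trans hk.le)
  have e2 : ¬ (⟨k, hkn⟩ : Fin n) ≤ j := not_le.2 hk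
  rw [labelAt, dif_pos hkn, glue, dif_neg e1, dif_neg e2]

/-- The matrix of the gate on the pair `k` when the output labels are `s`. -/
def siteMatrix {n : ℕ} (C : Circuit n) (s : ℕ → Fin 2) (k : ℕ) : Matrix (Fin 2) (Fin 2) ℂ :=
  link (gateAt C k) k (s k) (s (k + 1))

/-- The part of the matrix product to the left of the block, after the outcome `b`. The labels to the
right of the block do not enter and are set to `0`. -/
def leftFactor {n : ℕ} {i j : Fin n} (C : Circuit n) (b : BlockConf i j) :
    Matrix (LeftConf i) (Fin 2) ℂ :=
  Matrix.of fun a x => chainVec (Pi.single (labelAt (glue a b 0) 0) 1)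
    (siteMatrix C (labelAt (glue a b 0))) i x

/-- The part of the matrix product within the block. -/
def blockFactor {n : ℕ} {i j : Fin n} (C : Circuit n) (b : BlockConf i j) :
    Matrix (Fin 2) (Fin 2) ℂ :=
  ((List.range (j - i)).map fun k => siteMatrix C (blockAt b) (i + k)).prod

/-- The part of the matrix product to the right of the block, after the outcome `b`. The labels to the
left of the block do not enter and are set to `0`. -/
def rightFactor {m : ℕ} {i j : Fin (m + 1)} (C : Circuit (m + 1)) (b : BlockConf i j) :
    Matrix (Fin 2) (RightConf j) ℂ :=
  Matrix.of fun y c => chainVec (endVec m (labelAt (glue 0 b c) m))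
    (fun k => (siteMatrix C (labelAt (glue 0 b c)) (m - 1 - k)).transpose) (m - j) y

theorem outputState_glue {m : ℕ} {i j : Fin (m + 1)} (hij : i ≤ j) (C : Circuit (m + 1))
    (b : BlockConf i j) :
    (Matrix.of fun a c => outputState C (glue a b c)) =
      leftFactor C b * blockFactor C b * rightFactor C b := by
  ext a c
  have hij' : (i : ℕ) ≤ j := hij
  have hj := j.2
  have hleft : ∀ k : ℕ, k ≤ j → labelAt (glue a b c) k = labelAt (glue a b 0) k := by
    intro k hk
    rcases lt_or_ge k (i : ℕ) with h | h
    · rw [labelAt_glue_left _ _ _ h, labelAt_glue_left _ _ _ h]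
    · rw [labelAt_glue_block _ _ _ h hk, labelAt_glue_block _ _ _ h hk]
  have hright : ∀ k : ℕ, (j : ℕ) ≤ k → k ≤ m →
      labelAt (glue a b c) k = labelAt (glue 0 b c) k := by
    intro k hk hkm
    rcases hk.eq_or_lt with h | h
    · rw [labelAt_glue_block _ _ _ (by omega) h.ge, labelAt_glue_block _ _ _ (by omega) h.ge]
    · rw [labelAt_glue_right hij _ _ _ h (by omega), labelAt_glue_right hij _ _ _ h (by omega)]
  rw [Matrix.of_apply, outputState_eq_chainVec]
  change ∑ y : Fin 2, chainVec (Pi.single (labelAt (glue a b c) 0) (1 : ℂ))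
    (siteMatrix C (labelAt (glue a b c))) m y * endVec m (labelAt (glue a b c) m) y = _
  rw [sum_chainVec_split _ _ _ (show m - j ≤ m by omega),
    show m - (m - (j : ℕ)) = i + (j - i) by omega, chainVec_add, Matrix.mul_apply]
  refine Finset.sum_congr rfl fun y _ => ?_
  congr 1
  · rw [Matrix.mul_apply, Matrix.vecMul, dotProduct]
    refine Finset.sum_congr rfl fun x _ => ?_
    congr 1
    · rw [leftFactor, Matrix.of_apply, hleft 0 (by omega)]
      refine congrFun (chainVec_congr fun k hk => ?_) x
      rw [siteMatrix, siteMatrix, hleft k (by omega), hleft (k + 1) (by omega)]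
    · rw [blockFactor]
      rw [List.map_congr_left (g := fun k => siteMatrix C (blockAt b) (i + k)) fun k hk => ?_]
      have := List.mem_range.1 hk
      rw [siteMatrix, siteMatrix, labelAt_glue_block _ _ _ (by omega) (by omega),
        labelAt_glue_block _ _ _ (by omega) (by omega)]
  · rw [rightFactor, Matrix.of_apply, hright m (by omega) le_rfl]
    refine congrFun (chainVec_congr fun k hk => ?_) y
    rw [siteMatrix, siteMatrix, hright _ (by omega) (by omega), hright _ (by omega) (by omega)]

theorem leftFactor_gram {n : ℕ} {i j : Fin n} (hij : i ≤ j) (C : Circuit n) (b : BlockConf i j) :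
    (leftFactor C b).conjTranspose * leftFactor C b = leftGram C i (blockAt b i) := by
  have hij' : (i : ℕ) ≤ j := hij
  ext x y
  let e : (Fin i → Fin 2) ≃ LeftConf i :=
    { toFun := fun t q => t ⟨q.1, q.2⟩
      invFun := fun a k => a ⟨⟨k, k.2.trans i.2⟩, k.2⟩
      left_inv := fun _ => rfl
      right_inv := fun _ => rfl }
  rw [leftGram, gram_eq_sum _ _ _ _ _ _ (fun t => labelAt (glue (e t) b (0 : RightConf j))),
    Matrix.mul_apply, ← e.sum_comp]
  · rfl
  · intro t k
    rw [labelAt_glue_left _ _ _ k.2]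
    rfl
  · intro t
    exact labelAt_glue_block _ _ _ le_rfl hij'

theorem rightFactor_gram {m : ℕ} {i j : Fin (m + 1)} (hij : i ≤ j) (C : Circuit (m + 1))
    (b : BlockConf i j) :
    rightFactor C b * (rightFactor C b).conjTranspose =
      (rightGram C (m - j) (blockAt b j)).transpose := by
  have hij' : (i : ℕ) ≤ j := hij
  have hj := j.2
  ext x y
  let e : (Fin (m - j) → Fin 2) ≃ RightConf j :=
    { toFun := fun t q => t ⟨m - q.1, by
        have h1 := q.1.2
        have h2 : (j : ℕ) < q.1 := q.2
        omega⟩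
      invFun := fun c k => c ⟨⟨m - k, by omega⟩, by
        have := k.2
        rw [Fin.lt_def]
        simp only
        omega⟩
      left_inv := fun t => by
        funext k
        have := k.2
        simp only
        congr 1
        ext
        simp only
        omega
      right_inv := fun c => by
        funext q
        have h1 := q.1.2
        have h2 : (j : ℕ) < q.1 := q.2
        simp only
        congr 1
        ext
        simp only
        omega }
  rw [Matrix.transpose_apply, rightGram, gram_eq_sum _ _ _ _ _ _
    (fun t k => labelAt (glue (0 : LeftConf i) b (e t)) (m - k)), Matrix.mul_apply, ← e.sum_comp]
  · refine Finset.sum_congr rfl fun t _ => ?_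
    have hc : chainVec (endVec m (labelAt (glue 0 b (e t)) (m - 0)))
        (fun k => (link (gateAt C (m - 1 - k)) (m - 1 - k)
          (labelAt (glue (0 : LeftConf i) b (e t)) (m - (k + 1)))
          (labelAt (glue (0 : LeftConf i) b (e t)) (m - k))).transpose) (m - j) =
        chainVec (endVec m (labelAt (glue 0 b (e t)) m))
          (fun k => (siteMatrix C (labelAt (glue 0 b (e t))) (m - 1 - k)).transpose) (m - j) := by
      rw [Nat.sub_zero]
      refine chainVec_congr fun k hk => ?_
      rw [siteMatrix, show m - (k + 1) = m - 1 - k by omega, show m - 1 - k + 1 = m - k by omega]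
    rw [hc, mul_comm]
    rfl
  · intro t k
    have := k.2
    rw [labelAt_glue_right hij _ _ _ (by omega) (by omega)]
    simp only [e, Equiv.coe_fn_mk]
    congr 1
    ext
    simp only
    omega
  · intro t
    rw [show m - (m - (j : ℕ)) = j by omega]
    exact labelAt_glue_block _ _ _ hij' le_rfl

theorem norm_det_blockFactor {n : ℕ} {i j : Fin n} (C : Circuit n) (b : BlockConf i j) :
    ‖(blockFactor C b).det‖ = ∏ k : Fin (j - i), ‖(siteMatrix C (blockAt b) (i + k)).det‖ := by
  rw [Fin.prod_univ_eq_prod_range (fun k => ‖(siteMatrix C (blockAt b) (i + k)).det‖), blockFactor,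
    ← Matrix.coe_detMonoidHom, map_list_prod, List.map_map]
  induction (j - i : ℕ) with
  | zero => simp
  | succ p ih =>
    rw [List.range_succ, List.map_append, List.prod_append, norm_mul, ih, Finset.prod_range_succ]
    simp

/-- The contribution of one outcome factorizes into determinants along the chain. -/
theorem outcomeProb_mul_entropy_le {m : ℕ} {i j : Fin (m + 1)} (hij : i ≤ j)
    (C : Circuit (m + 1)) (b : BlockConf i j) :
    outcomeProb (outputState C) b * entanglementEntropy (postState (outputState C) b) ≤
      2 * (√(leftGram C i (blockAt b i)).det.re *
        (∏ k : Fin (j - i), ‖(siteMatrix C (blockAt b) (i + k)).det‖) *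
        √(rightGram C (m - j) (blockAt b j)).det.re) := by
  have h := mul_entropy_le (fun s : LeftConf i × RightConf j => outputState C (glue s.1 b s.2))
    _ _ _ (outputState_glue hij C b) (p := outcomeProb (outputState C) b) rfl
  rwa [leftFactor_gram hij, rightFactor_gram hij, Matrix.det_transpose, norm_det_blockFactor] at h

/-! ### Summation over the outcomes -/

theorem sum_blockConf {n : ℕ} {i j : Fin n} (hij : i ≤ j) (f g : Fin 2 → ℝ)
    (W : ℕ → Matrix (Fin 2) (Fin 2) ℝ) :
    ∑ b : BlockConf i j, f (blockAt b i) *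
        (∏ k : Fin (j - i), W k (blockAt b (i + k)) (blockAt b (i + k + 1))) * g (blockAt b j) =
      ∑ y, chainVec f W (j - i) y * g y := by
  have hij' : (i : ℕ) ≤ j := hij
  rw [← sum_prod_eq_chainVec]
  have hj := j.2
  let e : BlockConf i j ≃ (Fin (j - i + 1) → Fin 2) :=
    { toFun := fun b k => b ⟨⟨i + k, by omega⟩, by
        have := k.2
        constructor <;> rw [Fin.le_def] <;> simp only <;> omega⟩
      invFun := fun t q => t ⟨q.1 - i, by
        have h1 : (i : ℕ) ≤ q.1 := q.2.1
        have h2 : (q.1 : ℕ) ≤ j := q.2.2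
        omega⟩
      left_inv := fun b => by
        funext q
        have h1 : (i : ℕ) ≤ q.1 := q.2.1
        simp only
        congr 1
        ext
        simp only
        omega
      right_inv := fun t => by
        funext k
        simp only
        congr 1
        ext
        simp only
        omega }
  have he : ∀ (b : BlockConf i j) (k : Fin (j - i + 1)) (l : ℕ), l = i + k → blockAt b l = e b k := by
    intro b k l hl
    subst hl
    rw [blockAt, dif_pos (by omega)]
    rfl
  refine Fintype.sum_equiv e _ _ fun b => ?_
  rw [he b 0 i (by simp), he b (Fin.last _) j (by simp; omega)]
  congr 2
  refine Finset.prod_congr rfl fun k _ => ?_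
  rw [he b k.castSucc _ (by simp), he b k.succ _ (by simp; omega)]

/-- Whatever the gate, a measured second-layer pair transmits at most as much concurrence as a
maximally entangled projection in all four outcomes. -/
theorem sum_norm_det_measMatrix_le (U : Gate) :
    ∑ u, ∑ v, ‖(measMatrix U u v).det‖ ≤ 2 := by
  have h1 : ∀ u v, 2 * ‖(measMatrix U u v).det‖ ≤
      ((measMatrix U u v).conjTranspose * measMatrix U u v).trace.re := by
    intro u v
    rw [← sqrt_det_conjTranspose_mul_self]
    exact two_mul_sqrt_det_le_trace (Matrix.posSemidef_conjTranspose_mul_self _)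
  have h2 : ∑ u, ∑ v, ((measMatrix U u v).conjTranspose * measMatrix U u v).trace = 4 := by
    have h := isIsometryFamily_measMatrix U
    have h00 := h 0 0 0 0
    have h01 := h 0 1 0 1
    have h10 := h 1 0 1 0
    have h11 := h 1 1 1 1
    simp only [and_self, if_true, Fin.sum_univ_two] at h00 h01 h10 h11
    simp only [Matrix.trace, Matrix.diag_apply, Matrix.mul_apply, Matrix.conjTranspose_apply,
      Fin.sum_univ_two]
    linear_combination h00 + h01 + h10 + h11
  have h3 : ∑ u, ∑ v, 2 * ‖(measMatrix U u v).det‖ ≤ 4 := by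
    refine (Finset.sum_le_sum fun u _ => Finset.sum_le_sum fun v _ => h1 u v).trans_eq ?_
    simp only [← Complex.re_sum]
    rw [h2]
    rfl
  simp only [← Finset.mul_sum] at h3
  linarith

/-- The pairs of the first layer that meet the block of the qubits `i, …, r - 1`. -/
def firstLayerPairs (i r : ℕ) : Finset ℕ := (Finset.Ico (i - 1) r).filter Even

theorem prod_firstLayerPairs_succ (f : ℕ → ℝ) {i r : ℕ} (h : i ≤ r) :
    ∏ k ∈ firstLayerPairs i (r + 1), f k =
      (∏ k ∈ firstLayerPairs i r, f k) * if Even r then f r else 1 := by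
  rw [firstLayerPairs, firstLayerPairs, Finset.prod_filter, Finset.prod_filter,
    Finset.prod_Ico_succ_top (by omega)]

/-- The partial sums over the outcomes of the first qubits of the block. They are bounded by a
product over first-layer gates alone, because the second-layer factors are summed out. -/
theorem chainVec_det_le {m : ℕ} {i j : Fin (m + 1)} (C : Circuit (m + 1)) {q : ℕ}
    (hq : i + q ≤ j) :
    let v := chainVec (fun u => √(leftGram C i u).det.re)
      (fun k => Matrix.of fun u v => ‖(link (gateAt C (i + k)) (i + k) u v).det‖) q
    (∀ y, 0 ≤ v y) ∧
      (Even (i + q : ℕ) → ∑ y, v y ≤ ∏ k ∈ firstLayerPairs i (i + q), concurrenceAt C k) ∧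
      (¬ Even (i + q : ℕ) →
        ∀ y, v y ≤ (∏ k ∈ firstLayerPairs i (i + q), concurrenceAt C k) / 2) := by
  induction q with
  | zero =>
    refine ⟨fun y => Real.sqrt_nonneg _, fun he => ?_, fun ho y => ?_⟩
    · have : firstLayerPairs i (i + 0) = ∅ := by
        refine Finset.filter_eq_empty_iff.2 fun k hk => ?_
        rw [Finset.mem_Ico] at hk
        rw [Nat.even_iff] at he ⊢
        omega
      rw [this, Finset.prod_empty]
      exact sum_sqrt_leftGram_le C (by simpa using he)
    · obtain ⟨k, hk⟩ : ∃ k, (i : ℕ) = k + 1 := by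
        refine ⟨i - 1, ?_⟩
        rw [Nat.even_iff] at ho
        omega
      have hke : Even k := by
        rw [Nat.add_zero, hk, Nat.even_add_one, not_not] at ho
        exact ho
      have : firstLayerPairs i (i + 0) = {k} := by
        ext l
        rw [firstLayerPairs, Finset.mem_filter, Finset.mem_Ico, Finset.mem_singleton]
        constructor
        · omega
        · rintro rfl
          exact ⟨by omega, hke⟩
      rw [this, Finset.prod_singleton]
      have hi := i.2
      refine le_of_eq ?_
      simp only [chainVec]
      rw [hk]
      exact sqrt_leftGram_eq C hke (by omega) y
  | succ q ih =>
    obtain ⟨h0, h1, h2⟩ := ih (by omega)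
    set v := chainVec (fun u => √(leftGram C i u).det.re)
      (fun k => Matrix.of fun u v => ‖(link (gateAt C (i + k)) (i + k) u v).det‖) with hv
    have hj := j.2
    have hstep : ∀ y, v (q + 1) y =
        ∑ x, v q x * ‖(link (gateAt C (i + q)) (i + q) x y).det‖ := fun y => rfl
    have hp0 : 0 ≤ ∏ k ∈ firstLayerPairs i (i + q), concurrenceAt C k :=
      Finset.prod_nonneg fun k _ => concurrenceAt_nonneg C k
    simp only
    rw [← add_assoc, prod_firstLayerPairs_succ _ (by omega)]
    refine ⟨fun y => ?_, fun he => ?_, fun ho y => ?_⟩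
    · rw [hstep]
      exact Finset.sum_nonneg fun x _ => mul_nonneg (h0 x) (norm_nonneg _)
    · rw [Nat.even_add_one] at he
      rw [if_neg he, mul_one]
      have hl : ∀ x y, link (gateAt C (i + q)) (i + q) x y = measMatrix (gateAt C (i + q)) x y :=
        fun x y => by simp [link, he]
      simp only [hstep, hl]
      rw [Finset.sum_comm]
      simp only [← Finset.mul_sum]
      calc ∑ x, v q x * ∑ y, ‖(measMatrix (gateAt C (i + q)) x y).det‖
          ≤ ∑ x, (∏ k ∈ firstLayerPairs i (i + q), concurrenceAt C k) / 2 *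
              ∑ y, ‖(measMatrix (gateAt C (i + q)) x y).det‖ :=
            Finset.sum_le_sum fun x _ => mul_le_mul_of_nonneg_right (h2 he x)
              (Finset.sum_nonneg fun y _ => norm_nonneg _)
        _ ≤ (∏ k ∈ firstLayerPairs i (i + q), concurrenceAt C k) / 2 * 2 := by
            rw [← Finset.mul_sum]
            exact mul_le_mul_of_nonneg_left (sum_norm_det_measMatrix_le _) (by positivity)
        _ = _ := by ring
    · rw [Nat.even_add_one, not_not] at ho
      have hl : ∀ x, ‖(link (gateAt C (i + q)) (i + q) x y).det‖ = concurrenceAt C (i + q) / 2 := by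
        intro x
        rw [concurrenceAt, if_pos (by omega), concurrence]
        simp [link, ho]
      rw [if_pos ho, hstep]
      simp only [hl]
      rw [← Finset.sum_mul]
      calc (∑ x, v q x) * (concurrenceAt C (i + q) / 2)
          ≤ (∏ k ∈ firstLayerPairs i (i + q), concurrenceAt C k) * (concurrenceAt C (i + q) / 2) :=
            mul_le_mul_of_nonneg_right (h1 ho) (by linarith [concurrenceAt_nonneg C (i + q)])
        _ = _ := by ring

/-- For every instance of the circuit, the mean entropy is at most the product of the concurrences
of the states prepared by the first layer on the pairs that meet the block. -/
theorem expectedPostEntropy_le {m : ℕ} {i j : Fin (m + 1)} (hij : i ≤ j) (C : Circuit (m + 1)) :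
    expectedPostEntropy i j (outputState C) ≤
      ∏ k ∈ firstLayerPairs i (j + 1), concurrenceAt C k := by
  have hij' : (i : ℕ) ≤ j := hij
  have hj := j.2
  refine (Finset.sum_le_sum fun b _ => outcomeProb_mul_entropy_le hij C b).trans ?_
  rw [← Finset.mul_sum]
  have hs := sum_blockConf hij (fun u => √(leftGram C i u).det.re)
    (fun u => √(rightGram C (m - j) u).det.re)
    (fun k => Matrix.of fun u v => ‖(link (gateAt C (i + k)) (i + k) u v).det‖)
  simp only [Matrix.of_apply] at hs
  simp only [siteMatrix]
  rw [hs, prod_firstLayerPairs_succ _ hij']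
  obtain ⟨h0, h1, h2⟩ := chainVec_det_le (i := i) (j := j) C (q := j - i) (by omega)
  rw [show (i : ℕ) + (j - i) = j by omega] at h1 h2
  have hp0 : 0 ≤ ∏ k ∈ firstLayerPairs i j, concurrenceAt C k :=
    Finset.prod_nonneg fun k _ => concurrenceAt_nonneg C k
  by_cases he : Even (j : ℕ)
  · simp only [sqrt_rightGram_eq C (show (j : ℕ) ≤ m by omega) he, if_pos he]
    rw [← Finset.sum_mul]
    have := mul_le_mul_of_nonneg_right (h1 he) (concurrenceAt_nonneg C j)
    linarith
  · rw [if_neg he, mul_one]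
    have h3 := sum_sqrt_rightGram_le C (show (j : ℕ) ≤ m by omega) he
    calc _ ≤ 2 * ∑ y, (∏ k ∈ firstLayerPairs i j, concurrenceAt C k) / 2 *
            √(rightGram C (m - j) y).det.re := by
          refine mul_le_mul_of_nonneg_left (Finset.sum_le_sum fun y _ => ?_) (by norm_num)
          exact mul_le_mul_of_nonneg_right (h2 he y) (Real.sqrt_nonneg _)
      _ = (∏ k ∈ firstLayerPairs i j, concurrenceAt C k) *
            ∑ y, √(rightGram C (m - j) y).det.re := by
          rw [← Finset.mul_sum]
          ring
      _ ≤ _ := mul_le_of_le_one_right hp0 h3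

/-! ### Measurability -/

theorem continuous_gate_entry (z w : Fin 2 × Fin 2) :
    Continuous fun U : Gate => (U : Matrix (Fin 2 × Fin 2) (Fin 2 × Fin 2) ℂ) z w :=
  (continuous_apply_apply z w).comp continuous_subtype_val

theorem measurable_gate_entry {n : ℕ} (k : Fin (n - 1)) (z w : Fin 2 × Fin 2) :
    Measurable fun C : Circuit n => (C k : Matrix (Fin 2 × Fin 2) (Fin 2 × Fin 2) ℂ) z w :=
  (continuous_gate_entry z w).measurable.comp (measurable_pi_apply k)

theorem measurable_foldl_applyGate {n : ℕ} (l : List (Fin (n - 1))) (φ : Circuit n → StateVec n)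
    (hφ : ∀ s, Measurable fun C => φ C s) (s : Fin n → Fin 2) :
    Measurable fun C =>
      l.foldl (fun φ k => applyGate (C k) (leftQubit k) (rightQubit k) φ) (φ C) s := by
  induction l generalizing φ with
  | nil => exact hφ s
  | cons k l ih =>
    refine ih (fun C => applyGate (C k) (leftQubit k) (rightQubit k) (φ C)) fun s => ?_
    exact Finset.measurable_sum _ fun t _ => (measurable_gate_entry k _ _).mul (hφ _)

theorem measurable_outputState {n : ℕ} (s : Fin n → Fin 2) :
    Measurable fun C : Circuit n => outputState C s := by
  unfold outputState applyLayer
  exact measurable_foldl_applyGate _ _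
    (measurable_foldl_applyGate _ (fun _ => zeroState n) fun _ => measurable_const) s

theorem measurable_expectedPostEntropy {m : ℕ} {i j : Fin (m + 1)} (hij : i ≤ j) :
    Measurable fun C : Circuit (m + 1) => expectedPostEntropy i j (outputState C) := by
  have hp : ∀ b : BlockConf i j,
      Measurable fun C : Circuit (m + 1) => outcomeProb (outputState C) b := fun b =>
    Finset.measurable_sum _ fun a _ => Finset.measurable_sum _ fun c _ =>
      (measurable_outputState _).norm.pow_const 2
  have hs : ∀ (b : BlockConf i j) (z : LeftConf i × RightConf j),
      Measurable fun C : Circuit (m + 1) => postState (outputState C) b z := fun b z =>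
    (measurable_outputState _).div (Complex.measurable_ofReal.comp (hp b).sqrt)
  have hr : ∀ (b : BlockConf i j) (a a' : LeftConf i), Measurable fun C : Circuit (m + 1) =>
      reducedDensity (postState (outputState C) b) a a' := fun b a a' =>
    Finset.measurable_sum _ fun c _ => (hs b _).mul (Complex.continuous_conj.measurable.comp (hs b _))
  have e : ∀ C : Circuit (m + 1), expectedPostEntropy i j (outputState C) =
      ∑ b : BlockConf i j, outcomeProb (outputState C) b * purityEntropy
        (∑ a, ∑ a', reducedDensity (postState (outputState C) b) a a' *
          reducedDensity (postState (outputState C) b) a' a).re := by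
    intro C
    refine Finset.sum_congr rfl fun b _ => ?_
    exact mul_entropy_eq (fun s : LeftConf i × RightConf j => outputState C (glue s.1 b s.2)) _ _
      ((outputState_glue hij C b).trans (Matrix.mul_assoc _ _ _)) rfl
  simp only [e]
  refine Finset.measurable_sum _ fun b _ => (hp b).mul (measurable_purityEntropy.comp ?_)
  exact Complex.measurable_re.comp (Finset.measurable_sum _ fun a _ =>
    Finset.measurable_sum _ fun a' _ => (hr b a a').mul (hr b a' a))

theorem expectedPostEntropy_nonneg {m : ℕ} {i j : Fin (m + 1)} (hij : i ≤ j)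
    (C : Circuit (m + 1)) : 0 ≤ expectedPostEntropy i j (outputState C) :=
  Finset.sum_nonneg fun b _ =>
    mul_entropy_nonneg (fun s : LeftConf i × RightConf j => outputState C (glue s.1 b s.2)) _ _ _
      (outputState_glue hij C b) rfl

/-! ### The average over the gates -/

theorem concurrenceAt_le_one {n : ℕ} (C : Circuit n) (k : ℕ) : concurrenceAt C k ≤ 1 := by
  unfold concurrenceAt
  split_ifs
  exacts [concurrence_le_one _, zero_le_one]

instance circuitLaw_isProbabilityMeasure (n : ℕ) : IsProbabilityMeasure (circuitLaw n) := by
  unfold circuitLaw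
  infer_instance

theorem integrable_expectedPostEntropy {m : ℕ} {i j : Fin (m + 1)} (hij : i ≤ j) :
    Integrable (fun C : Circuit (m + 1) => expectedPostEntropy i j (outputState C))
      (circuitLaw (m + 1)) := by
  refine Integrable.of_bound (measurable_expectedPostEntropy hij).aestronglyMeasurable 1
    (Filter.Eventually.of_forall fun C => ?_)
  rw [Real.norm_of_nonneg (expectedPostEntropy_nonneg hij C)]
  exact (expectedPostEntropy_le hij C).trans
    (Finset.prod_le_one (fun k _ => concurrenceAt_nonneg C k) fun k _ => concurrenceAt_le_one C k)

theorem continuous_concurrence : Continuous concurrence := by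
  have h : ∀ x y, Continuous fun U : Gate => prepMatrix U x y := fun x y =>
    continuous_gate_entry (x, y) (0, 0)
  unfold concurrence
  simp only [Matrix.det_fin_two]
  exact continuous_const.mul (((h 0 0).mul (h 1 1)).sub ((h 0 1).mul (h 1 0))).norm

/-- The mean concurrence of a Haar-random two-qubit state. -/
def meanConcurrence : ℝ := ∫ U, concurrence U ∂haarGate

theorem integrable_concurrence : Integrable concurrence haarGate :=
  Integrable.of_bound continuous_concurrence.measurable.aestronglyMeasurable 1
    (Filter.Eventually.of_forall fun U => by
      rw [Real.norm_of_nonneg (concurrence_nonneg U)]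
      exact concurrence_le_one U)

theorem meanConcurrence_nonneg : 0 ≤ meanConcurrence := integral_nonneg concurrence_nonneg

theorem concurrence_one : concurrence 1 = 0 := by
  simp [concurrence, prepMatrix, Matrix.det_fin_two]

/-- The concurrence is continuous, at most `1`, and vanishes at the identity gate, so its mean is
less than `1`. -/
theorem meanConcurrence_lt_one : meanConcurrence < 1 := by
  have hpos : 0 < ∫ U, (1 - concurrence U) ∂haarGate := by
    have : haarGate.IsHaarMeasure := by
      unfold haarGate
      infer_instance
    refine Continuous.integral_pos_of_hasCompactSupport_nonneg_nonzero
      (x := (1 : Gate)) (continuous_const.sub continuous_concurrence)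
      (HasCompactSupport.of_compactSpace _) (fun U => sub_nonneg.2 (concurrence_le_one U)) ?_
    rw [concurrence_one]
    norm_num
  rw [integral_sub (integrable_const _) integrable_concurrence] at hpos
  simpa [meanConcurrence] using hpos

theorem integral_prod_concurrenceAt {n : ℕ} (S : Finset ℕ) (hS : ∀ k ∈ S, k < n - 1) :
    ∫ C : Circuit n, ∏ k ∈ S, concurrenceAt C k ∂circuitLaw n = meanConcurrence ^ S.card := by
  have e : ∀ C : Circuit n, ∏ k ∈ S, concurrenceAt C k =
      ∏ k : Fin (n - 1), (fun U => if (k : ℕ) ∈ S then concurrence U else 1) (C k) := by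
    intro C
    have h1 : ∀ k : Fin (n - 1), (fun U => if (k : ℕ) ∈ S then concurrence U else 1) (C k) =
        (fun l : ℕ => if l ∈ S then concurrenceAt C l else 1) k := by
      intro k
      simp [concurrenceAt, gateAt]
    rw [Finset.prod_congr rfl fun k _ => h1 k,
      Fin.prod_univ_eq_prod_range (fun l : ℕ => if l ∈ S then concurrenceAt C l else 1),
      ← Finset.prod_filter]
    congr 1
    ext k
    simp only [Finset.mem_filter, Finset.mem_range]
    exact ⟨fun h => ⟨hS k h, h⟩, fun h => h.2⟩
  simp only [e]
  rw [circuitLaw, integral_fintype_prod_eq_prod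
    (f := fun (k : Fin (n - 1)) (U : Gate) => if (k : ℕ) ∈ S then concurrence U else 1)]
  have h2 : ∀ k : Fin (n - 1), ∫ U, (if (k : ℕ) ∈ S then concurrence U else 1) ∂haarGate =
      (fun l : ℕ => if l ∈ S then meanConcurrence else 1) k := by
    intro k
    by_cases hk : (k : ℕ) ∈ S <;> simp [hk, meanConcurrence]
  rw [Finset.prod_congr rfl fun k _ => h2 k,
    Fin.prod_univ_eq_prod_range (fun l : ℕ => if l ∈ S then meanConcurrence else 1),
    ← Finset.prod_filter, Finset.prod_const]
  congr 2
  ext k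
  simp only [Finset.mem_filter, Finset.mem_range]
  exact ⟨fun h => h.2, fun h => ⟨hS k h, h⟩⟩

/-- About every second pair belongs to the first layer; the summand `r % 2` makes the bound
inductive in the right end `r` of the range. -/
theorem le_two_mul_card_firstLayerPairs {i r : ℕ} (hir : i ≤ r) :
    r - i + r % 2 ≤ 2 * (firstLayerPairs i r).card := by
  induction r, hir using Nat.le_induction with
  | base =>
    rw [Nat.sub_self, zero_add]
    rcases Nat.mod_two_eq_zero_or_one i with h | h
    · omega
    · have : i - 1 ∈ firstLayerPairs i i := by
        rw [firstLayerPairs, Finset.mem_filter, Finset.mem_Ico, Nat.even_iff]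
        omega
      have := Finset.card_pos.2 ⟨_, this⟩
      omega
  | succ r hr ih =>
    rcases Nat.mod_two_eq_zero_or_one r with h | h
    · have e : firstLayerPairs i (r + 1) = insert r (firstLayerPairs i r) := by
        ext k
        simp only [firstLayerPairs, Finset.mem_filter, Finset.mem_Ico, Finset.mem_insert,
          Nat.even_iff]
        omega
      rw [e, Finset.card_insert_of_notMem (by simp [firstLayerPairs])]
      omega
    · have := Finset.card_le_card (show firstLayerPairs i r ⊆ firstLayerPairs i (r + 1) from
        Finset.filter_subset_filter _ (Finset.Ico_subset_Ico_right (Nat.le_succ r)))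
      omega

theorem integral_prod_firstLayerPairs_le {n : ℕ} (i r : ℕ) :
    ∫ C : Circuit n, ∏ k ∈ firstLayerPairs i r, concurrenceAt C k ∂circuitLaw n ≤
      meanConcurrence ^ (firstLayerPairs i r).card := by
  by_cases hS : ∀ k ∈ firstLayerPairs i r, k < n - 1
  · exact (integral_prod_concurrenceAt _ hS).le
  · push Not at hS
    obtain ⟨k, hk, hkn⟩ := hS
    -- A missing pair means that the block reaches the last qubit, and the product vanishes.
    have : ∀ C : Circuit n, ∏ k ∈ firstLayerPairs i r, concurrenceAt C k = 0 := fun C =>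
      Finset.prod_eq_zero hk (by rw [concurrenceAt, if_neg (by omega)])
    simp only [this, integral_zero]
    exact pow_nonneg meanConcurrence_nonneg _

theorem integrable_prod_concurrenceAt {n : ℕ} (S : Finset ℕ) :
    Integrable (fun C : Circuit n => ∏ k ∈ S, concurrenceAt C k) (circuitLaw n) := by
  have hm : ∀ k, Measurable fun C : Circuit n => concurrenceAt C k := by
    intro k
    by_cases hk : k < n - 1
    · simp only [concurrenceAt, hk, if_true, gateAt, dif_pos]
      exact continuous_concurrence.measurable.comp (measurable_pi_apply _)
    · simp only [concurrenceAt, hk, if_false]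
      exact measurable_const
  refine Integrable.of_bound (Finset.measurable_fun_prod _ fun k _ => hm k).aestronglyMeasurable 1
    (Filter.Eventually.of_forall fun C => ?_)
  rw [Real.norm_of_nonneg (Finset.prod_nonneg fun k _ => concurrenceAt_nonneg C k)]
  exact Finset.prod_le_one (fun k _ => concurrenceAt_nonneg C k) fun k _ => concurrenceAt_le_one C k

end RandomCircuit

end

open RandomCircuit in
theorem mainTheorem3 :
    ∃ c : ℝ, 0 < c ∧ c < 1 ∧
      ∀ (n : ℕ) (i j : Fin n), i ≤ j →
        MeasureTheory.Integrable
            (fun C : RandomCircuit.Circuit n =>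
              RandomCircuit.expectedPostEntropy i j (RandomCircuit.outputState C))
            (RandomCircuit.circuitLaw n) ∧
          ∫ C : RandomCircuit.Circuit n,
              RandomCircuit.expectedPostEntropy i j (RandomCircuit.outputState C)
              ∂(RandomCircuit.circuitLaw n) ≤
            c ^ (Finset.Icc i j).card := by
  -- The maximum with `1 / 2` keeps the constant positive. The square root is taken because only
  -- about half of the pairs along the block belong to the first layer.
  set c₁ : ℝ := max meanConcurrence (1 / 2)
  have h0 : 0 < c₁ := lt_max_of_lt_right (by norm_num)
  have h1 : c₁ < 1 := max_lt meanConcurrence_lt_one (by norm_num)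
  have hs1 : √c₁ ≤ 1 := Real.sqrt_le_one.2 h1.le
  refine ⟨√c₁, Real.sqrt_pos.2 h0, (Real.sqrt_lt' one_pos).2 (by rwa [one_pow]),
    fun n i j hij => ?_⟩
  obtain ⟨m, rfl⟩ : ∃ m, n = m + 1 := ⟨n - 1, by have := i.2; omega⟩
  refine ⟨integrable_expectedPostEntropy hij, ?_⟩
  have hcard := le_two_mul_card_firstLayerPairs (i := i) (r := j + 1) (Nat.le_succ_of_le hij)
  calc _ ≤ ∫ C : Circuit (m + 1), ∏ k ∈ firstLayerPairs i (j + 1), concurrenceAt C k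
          ∂circuitLaw (m + 1) :=
        integral_mono (integrable_expectedPostEntropy hij) (integrable_prod_concurrenceAt _)
          fun C => expectedPostEntropy_le hij C
    _ ≤ meanConcurrence ^ (firstLayerPairs i (j + 1)).card := integral_prod_firstLayerPairs_le _ _
    _ ≤ c₁ ^ (firstLayerPairs i (j + 1)).card :=
        pow_le_pow_left₀ meanConcurrence_nonneg (le_max_left _ _) _
    _ = √c₁ ^ (2 * (firstLayerPairs i (j + 1)).card) := by
        rw [pow_mul, Real.sq_sqrt h0.le]
    _ ≤ √c₁ ^ (Finset.Icc i j).card := by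
        refine pow_le_pow_of_le_one (Real.sqrt_nonneg _) hs1 ?_
        rw [Fin.card_Icc]
        omega
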